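/- Let $n\ge 2$ and let $\frac12\le r_1,\dots,r_{n-1}<1$. Put $p_{i,j}=r_i$ and $p_{j,i}=1-r_i$ for $1\le i<j\le n$ ("Choose Your Weapon" parameters). Let $\mathcal M_{nn}$ be the Markov chain on the permutations $\sigma=(\sigma(1),\dots,\sigma(n))$ of $\{1,\dots,n\}$ which at each step chooses $i\in\{1,\dots,n-1\}$ uniformly at random, swaps $\sigma(i)$ and $\sigma(i+1)$ with probability $p_{\sigma(i+1),\sigma(i)}$, and does nothing with probability $p_{\sigma(i),\sigma(i+1)}$. Let $\mathcal P$ be its transition matrix and let $\pi(\sigma)=\frac1Z\prod_{i<j}p_{\sigma(i),\sigma(j)}$, with $Z$ the normalizing constant, be its stationary distribution. For $\epsilon>0$ let $\tau(\epsilon)=\min\{t:\ \max_{\sigma}\frac12\sum_{\rho}|\mathcal P^{t'}(\sigma,\rho)-\pi(\rho)|\le\epsilon\ \text{ for all } t'\ge t\}$ be the mixing time. 1. For every $R<1$ there is a constant $C$, depending only on $R$, such that for all $n\ge2$, all $r_1,\dots,r_{n-1}\in[\frac12,R]$ and all $0<\epsilon<1$, the mixing time of $\mathcal M_{nn}$ is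 finite and satisfies $\tau(\epsilon)\le C\,n^8\log(n/\epsilon)$. 2. For every $R<1$ and $\delta>0$ there is a constant $C$, depending only on $R$ and $\delta$, such that for all $n\ge2$, all $r_1,\dots,r_{n-1}\in[\frac12+\delta,R]$ and all $0<\epsilon<1$, the mixing time of $\mathcal M_{nn}$ is finite and satisfies $\tau(\epsilon)\le C\,n^7\log(n/\epsilon)$. -/

import Mathlib

/-- Worst-case total variation distance `max_x (1/2) ∑_y |Q x y - π y|` between the rows of a
transition matrix `Q` and a distribution `π` on a finite set (the supremum is over a finite set). -/
noncomputable def tvDist {Ω : Type*} [Fintype Ω] (Q : Matrix Ω Ω ℝ) (π : Ω → ℝ) : ℝ :=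
  ⨆ x : Ω, (1 / 2 : ℝ) * ∑ y : Ω, |Q x y - π y|

/-- `τ` is the mixing time `min {t : ‖P^t', π‖_tv ≤ ε for all t' ≥ t}`; in particular the minimum
exists. -/
def IsMixingTime {Ω : Type*} [Fintype Ω] [DecidableEq Ω] (P : Matrix Ω Ω ℝ) (π : Ω → ℝ)
    (ε : ℝ) (τ : ℕ) : Prop :=
  IsLeast {t : ℕ | ∀ t' : ℕ, t ≤ t' → tvDist (P ^ t') π ≤ ε} τ

/-- The position `i`, for `i` ranging over the `n - 1` adjacent pairs `(i, i + 1)`. -/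
def leftPos {n : ℕ} (i : Fin (n - 1)) : Fin n := ⟨i, by omega⟩

/-- The position `i + 1`, for `i` ranging over the `n - 1` adjacent pairs `(i, i + 1)`. -/
def rightPos {n : ℕ} (i : Fin (n - 1)) : Fin n := ⟨i + 1, by omega⟩

/-- Transition matrix of the nearest neighbour chain with parameters `p` on permutations of `n`
elements; `σ k` is the element in position `k`.  An adjacent pair of positions `(i, i + 1)` is
chosen uniformly among the `n - 1` pairs; the two elements there are swapped with probability
`p (σ (i + 1)) (σ i)` and left alone with probability `p (σ i) (σ (i + 1))`. -/
noncomputable def nnChain {n : ℕ} (p : Fin n → Fin n → ℝ) :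
    Matrix (Equiv.Perm (Fin n)) (Equiv.Perm (Fin n)) ℝ :=
  fun σ τ => ∑ i : Fin (n - 1), (1 / ((n - 1 : ℕ) : ℝ)) *
    ((if τ = σ * Equiv.swap (leftPos i) (rightPos i)
        then p (σ (rightPos i)) (σ (leftPos i)) else 0) +
      (if τ = σ then p (σ (leftPos i)) (σ (rightPos i)) else 0))

/-- The weight `∏_{i < j} p_{σ(i), σ(j)}` of a permutation. -/
def permWeight {n : ℕ} (p : Fin n → Fin n → ℝ) (σ : Equiv.Perm (Fin n)) : ℝ :=
  ∏ i : Fin n, ∏ j ∈ Finset.Ioi i, p (σ i) (σ j)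

/-- The distribution on biased permutations, `π(σ) = ∏_{i < j} p_{σ(i), σ(j)} / Z`, which is the
stationary distribution of the nearest neighbour chain. -/
noncomputable def biasedPerm {n : ℕ} (p : Fin n → Fin n → ℝ) (σ : Equiv.Perm (Fin n)) : ℝ :=
  permWeight p σ / ∑ ρ : Equiv.Perm (Fin n), permWeight p ρ

/-- "Choose Your Weapon" parameters: `p_{i,j} = r_i` and `p_{j,i} = 1 - r_i` for `i < j`
(the diagonal entries of `p` are never used). -/
def IsChooseYourWeapon {n : ℕ} (r : Fin (n - 1) → ℝ) (p : Fin n → Fin n → ℝ) : Prop :=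
  ∀ i j : Fin n, ∀ h : i < j,
    p i j = r ⟨i, by omega⟩ ∧ p j i = 1 - r ⟨i, by omega⟩

/-! A permutation is determined by the position `k` of its smallest value and by the order `τ` of
the rest. Every comparison with the smallest value `0` uses the same weapon, so the weight factors
as a truncated geometric weight in `k` times the weight of `τ` (`permWeight_insertPerm`). By
iteration, `biasedPerm` is a product of independent truncated geometric laws.

Each geometric law satisfies a Poincaré inequality with constant of order `n * T`, where `T` bounds
the sums of powers of `(1 - q) / q`. The variance is subadditive over independent coordinates, so
the product has the same constant for the form `transForm`, whose moves exchange two entries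
separated only by entries smaller than both (`poincare_transForm`). Such an exchange is compared
with adjacent ones by two paths of sorting swaps with a common endpoint. The weight never decreases
along them, and the cost is a factor `4 * n ^ 3` (`transForm_le`).

Each adjacent update is a conditional expectation, so one step of the chain lowers the second moment
by at least `totalEdgeForm / (2 * n)` (`sqMoment_nnChain_le`). Centred functions therefore contract
by `1 - 1 / (8 * n ^ 5 * T)` in squared norm. The least probability is at least `exp (-O(n ^ 2))`,
which gives `O(n ^ 7 * T * log (n / ε))` steps. In general `T = n`; with bias `δ`, `T = 1 / (2 *
δ)`. -/

/-! ### Splitting a permutation at its smallest value -/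

/-- The permutation of `n + 1` elements obtained from `τ` by shifting all values up and inserting
the smallest value at position `k`. -/
def insertPerm {n : ℕ} (k : Fin (n + 1)) (τ : Equiv.Perm (Fin n)) : Equiv.Perm (Fin (n + 1)) :=
  (finSuccEquiv' k).trans ((Equiv.optionCongr τ).trans (finSuccEquiv' 0).symm)

@[simp] theorem insertPerm_self {n : ℕ} (k : Fin (n + 1)) (τ : Equiv.Perm (Fin n)) :
    insertPerm k τ k = 0 := by
  simp [insertPerm]

@[simp] theorem insertPerm_succAbove {n : ℕ} (k : Fin (n + 1)) (τ : Equiv.Perm (Fin n))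
    (j : Fin n) : insertPerm k τ (k.succAbove j) = (τ j).succ := by
  simp [insertPerm]

theorem insertPerm_bijective (n : ℕ) :
    Function.Bijective (fun x : Fin (n + 1) × Equiv.Perm (Fin n) => insertPerm x.1 x.2) := by
  rw [Fintype.bijective_iff_injective_and_card]
  refine ⟨?_, by simp [Fintype.card_perm, Nat.factorial_succ]⟩
  rintro ⟨k, τ⟩ ⟨k', τ'⟩ h
  simp only at h
  have hk : k = k' := by
    apply (insertPerm k τ).injective
    rw [insertPerm_self, h, insertPerm_self]
  subst hk
  refine Prod.ext rfl (Equiv.ext fun j => ?_)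
  have := congrArg (fun e => e (k.succAbove j)) h
  simpa using this

theorem sum_perm_succ {n : ℕ} (F : Equiv.Perm (Fin (n + 1)) → ℝ) :
    ∑ σ, F σ = ∑ k, ∑ τ, F (insertPerm k τ) := by
  rw [← Fintype.sum_prod_type', ← (insertPerm_bijective n).sum_comp]

theorem insertPerm_mul_swap_succAbove {n : ℕ} (k : Fin (n + 1)) (τ : Equiv.Perm (Fin n))
    (a c : Fin n) :
    insertPerm k τ * Equiv.swap (k.succAbove a) (k.succAbove c) =
      insertPerm k (τ * Equiv.swap a c) := by
  ext x
  rcases Fin.eq_self_or_eq_succAbove k x with rfl | ⟨j, rfl⟩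
  · rw [Equiv.Perm.mul_apply, Equiv.swap_apply_of_ne_of_ne (Fin.succAbove_ne _ _).symm
      (Fin.succAbove_ne _ _).symm]
    simp
  · rw [Equiv.Perm.mul_apply, ← Fin.succAbove_right_injective.map_swap]
    simp

theorem insertPerm_succ_mul_swap {n : ℕ} (k : Fin n) (τ : Equiv.Perm (Fin n)) :
    insertPerm k.succ τ * Equiv.swap k.castSucc k.succ = insertPerm k.castSucc τ := by
  ext x
  rcases Fin.eq_self_or_eq_succAbove k.castSucc x with rfl | ⟨j, rfl⟩
  · simp
  · rw [Equiv.Perm.mul_apply, insertPerm_succAbove]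
    by_cases hj : j = k
    · subst hj
      rw [Fin.succAbove_castSucc_self, Equiv.swap_apply_right]
      have := insertPerm_succAbove j.succ τ j
      rw [Fin.succAbove_succ_self] at this
      rw [this]
    · have h : k.castSucc.succAbove j = k.succ.succAbove j := by
        rcases lt_or_gt_of_ne hj with h | h
        · rw [Fin.succAbove_castSucc_of_lt _ _ h,
            Fin.succAbove_succ_of_le _ _ h.le]
        · rw [Fin.succAbove_castSucc_of_le _ _ h.le,
            Fin.succAbove_succ_of_lt _ _ h]
      rw [Equiv.swap_apply_of_ne_of_ne (Fin.succAbove_ne _ _)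
        (h ▸ Fin.succAbove_ne _ _), h, insertPerm_succAbove]

/-! ### Factorization of the weight -/

/-- Choose Your Weapon parameters with a weapon `q i` for every element. -/
def HasWeapons {n : ℕ} (q : Fin n → ℝ) (p : Fin n → Fin n → ℝ) : Prop :=
  ∀ i j : Fin n, i < j → p i j = q i ∧ p j i = 1 - q i

theorem HasWeapons.succ {n : ℕ} {q : Fin (n + 1) → ℝ} {p : Fin (n + 1) → Fin (n + 1) → ℝ}
    (h : HasWeapons q p) :
    HasWeapons (fun i => q i.succ) (fun i j : Fin n => p i.succ j.succ) :=
  fun i j hij => h i.succ j.succ (Fin.succ_lt_succ_iff.2 hij)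

theorem permWeight_eq_prod_ite {n : ℕ} (p : Fin n → Fin n → ℝ) (σ : Equiv.Perm (Fin n)) :
    permWeight p σ = ∏ i, ∏ j, if i < j then p (σ i) (σ j) else 1 := by
  unfold permWeight
  refine Finset.prod_congr rfl fun i _ => ?_
  rw [← Finset.prod_filter]
  congr 1
  ext j
  simp

theorem prod_ite_val_lt {n k : ℕ} (hk : k ≤ n) (x y : ℝ) :
    (∏ m : Fin n, if (m : ℕ) < k then x else y) = x ^ k * y ^ (n - k) := by
  rw [Fin.prod_univ_eq_prod_range (fun m => if m < k then x else y) n,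
    ← Finset.prod_range_mul_prod_Ico _ hk]
  congr 1
  · rw [Finset.prod_congr rfl fun m hm => if_pos (Finset.mem_range.1 hm)]
    simp
  · rw [Finset.prod_congr rfl fun m hm => if_neg (not_lt.2 (Finset.mem_Ico.1 hm).1)]
    simp

/-- The `k` values in front of the smallest each contribute `1 - q 0`, the `n - k` behind it each
contribute `q 0`, and the remaining pairs do not see it. -/
theorem permWeight_insertPerm {n : ℕ} {q : Fin (n + 1) → ℝ}
    {p : Fin (n + 1) → Fin (n + 1) → ℝ} (h : HasWeapons q p) (k : Fin (n + 1))
    (τ : Equiv.Perm (Fin n)) :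
    permWeight p (insertPerm k τ) =
      (1 - q 0) ^ (k : ℕ) * q 0 ^ (n - (k : ℕ)) *
        permWeight (fun i j : Fin n => p i.succ j.succ) τ := by
  rw [permWeight_eq_prod_ite, permWeight_eq_prod_ite, Fin.prod_univ_succAbove _ k,
    Fin.prod_univ_succAbove _ k]
  simp only [Fin.prod_univ_succAbove _ k, insertPerm_self, insertPerm_succAbove, lt_irrefl,
    if_false, one_mul, Fin.succAbove_lt_succAbove_iff, Finset.prod_mul_distrib]
  rw [← mul_assoc, ← Finset.prod_mul_distrib]
  congr 1
  rw [← prod_ite_val_lt (Nat.lt_succ_iff.1 k.2)]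
  refine Finset.prod_congr rfl fun m _ => ?_
  obtain ⟨h1, h2⟩ := h 0 (τ m).succ (Fin.succ_pos _)
  rw [h1, h2]
  by_cases hm : (m : ℕ) < k
  · have h3 : k.succAbove m < k := by rwa [Fin.succAbove_lt_iff_castSucc_lt]
    rw [if_pos hm, if_pos h3, if_neg h3.not_gt, one_mul]
  · have h3 : k < k.succAbove m := by
      rw [Fin.lt_succAbove_iff_le_castSucc]
      exact not_lt.1 hm
    rw [if_neg hm, if_pos h3, if_neg h3.not_gt, mul_one]

theorem permWeight_pos {n : ℕ} {q : Fin n → ℝ} {p : Fin n → Fin n → ℝ} (h : HasWeapons q p)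
    (hq : ∀ i, 0 < q i ∧ q i < 1) (σ : Equiv.Perm (Fin n)) : 0 < permWeight p σ := by
  refine Finset.prod_pos fun i _ => Finset.prod_pos fun j hj => ?_
  have hne : σ i ≠ σ j := fun e => (Finset.mem_Ioi.1 hj).ne (σ.injective e)
  rcases lt_or_gt_of_ne hne with hl | hl
  · rw [(h _ _ hl).1]
    exact (hq _).1
  · rw [(h _ _ hl).2]
    linarith [(hq (σ j)).2]

/-! ### Poincaré inequality on an interval and tensorization -/

theorem sq_sub_le_sum_sq (n : ℕ) (g : ℕ → ℝ) {a b : ℕ} (hab : a ≤ b) (hb : b ≤ n) :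
    (g b - g a) ^ 2 ≤
      n * ∑ k ∈ Finset.range n, if a ≤ k ∧ k < b then (g (k + 1) - g k) ^ 2 else 0 := by
  have h1 : g b - g a = ∑ k ∈ Finset.Ico a b, (g (k + 1) - g k) :=
    (Finset.sum_Ico_sub g hab).symm
  have h2 : ∑ k ∈ Finset.range n, (if a ≤ k ∧ k < b then (g (k + 1) - g k) ^ 2 else 0) =
      ∑ k ∈ Finset.Ico a b, (g (k + 1) - g k) ^ 2 := by
    rw [← Finset.sum_filter]
    congr 1
    ext k
    simp only [Finset.mem_filter, Finset.mem_range, Finset.mem_Ico]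
    omega
  rw [h1, h2]
  refine sq_sum_le_card_mul_sum_sq.trans ?_
  refine mul_le_mul_of_nonneg_right ?_ (Finset.sum_nonneg fun _ _ => sq_nonneg _)
  rw [Nat.card_Ico]
  exact_mod_cast (by omega : b - a ≤ n)

/-- Poincaré inequality for a weight on `{0, …, n}` whose tails are controlled by their first
term. -/
theorem sum_sum_sq_sub_le (n : ℕ) (u g : ℕ → ℝ) (T : ℝ) (hu : ∀ k, 0 ≤ u k)
    (hT : ∀ k < n, ∑ b ∈ Finset.range (n + 1), (if k < b then u b else 0) ≤ T * u (k + 1)) :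
    ∑ a ∈ Finset.range (n + 1), ∑ b ∈ Finset.range (n + 1), u a * u b * (g a - g b) ^ 2 ≤
      2 * (∑ a ∈ Finset.range (n + 1), u a) *
        (n * T * ∑ k ∈ Finset.range n, u (k + 1) * (g (k + 1) - g k) ^ 2) := by
  set d : ℕ → ℝ := fun k => (g (k + 1) - g k) ^ 2 with hd
  have hd0 : ∀ k, 0 ≤ d k := fun k => sq_nonneg _
  set S := Finset.range (n + 1) with hS
  -- Telescoping and Cauchy–Schwarz charge each pair to the edges `k` separating `a` from `b`; the
  -- two products of indicators cover the two orders of `a` and `b`.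
  have key : ∀ a ∈ S, ∀ b ∈ S, u a * u b * (g a - g b) ^ 2 ≤
      ∑ k ∈ Finset.range n, n * d k *
        ((if a ≤ k then u a else 0) * (if k < b then u b else 0) +
          (if b ≤ k then u b else 0) * (if k < a then u a else 0)) := by
    intro a ha b hb
    have ha' : a ≤ n := Nat.lt_succ_iff.1 (Finset.mem_range.1 ha)
    have hb' : b ≤ n := Nat.lt_succ_iff.1 (Finset.mem_range.1 hb)
    have huu := mul_nonneg (hu a) (hu b)
    rcases le_total a b with h | h
    · have := mul_le_mul_of_nonneg_left (sq_sub_le_sum_sq n g h hb') huu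
      rw [← neg_sub, neg_sq]
      refine this.trans ?_
      rw [Finset.mul_sum, Finset.mul_sum]
      refine Finset.sum_le_sum fun k _ => ?_
      have hn : (0 : ℝ) ≤ n * d k := mul_nonneg (Nat.cast_nonneg _) (hd0 k)
      have hn' := mul_nonneg hn huu
      split_ifs <;> first | omega | (simp only [hd] at *; linarith)
    · have := mul_le_mul_of_nonneg_left (sq_sub_le_sum_sq n g h ha') huu
      refine this.trans ?_
      rw [Finset.mul_sum, Finset.mul_sum]
      refine Finset.sum_le_sum fun k _ => ?_
      have hn : (0 : ℝ) ≤ n * d k := mul_nonneg (Nat.cast_nonneg _) (hd0 k)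
      have hn' := mul_nonneg hn huu
      split_ifs <;> first | omega | (simp only [hd] at *; linarith)
  calc _ ≤ ∑ a ∈ S, ∑ b ∈ S, ∑ k ∈ Finset.range n, n * d k *
        ((if a ≤ k then u a else 0) * (if k < b then u b else 0) +
          (if b ≤ k then u b else 0) * (if k < a then u a else 0)) :=
        Finset.sum_le_sum fun a ha => Finset.sum_le_sum fun b hb => key a ha b hb
    _ = ∑ k ∈ Finset.range n, ∑ a ∈ S, ∑ b ∈ S, n * d k *
        ((if a ≤ k then u a else 0) * (if k < b then u b else 0) +
          (if b ≤ k then u b else 0) * (if k < a then u a else 0)) := by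
        conv_rhs => rw [Finset.sum_comm]
        refine Finset.sum_congr rfl fun a _ => Finset.sum_comm
    _ = ∑ k ∈ Finset.range n, n * d k *
        (2 * ((∑ a ∈ S, if a ≤ k then u a else 0) * ∑ b ∈ S, if k < b then u b else 0)) := by
        refine Finset.sum_congr rfl fun k _ => ?_
        simp_rw [← Finset.mul_sum, Finset.sum_add_distrib]
        rw [← Finset.sum_mul_sum, Finset.sum_comm, ← Finset.sum_mul_sum]
        ring
    _ ≤ ∑ k ∈ Finset.range n, n * d k * (2 * ((∑ a ∈ S, u a) * (T * u (k + 1)))) := by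
        refine Finset.sum_le_sum fun k hk => ?_
        have hn : (0 : ℝ) ≤ n * d k := mul_nonneg (Nat.cast_nonneg _) (hd0 k)
        refine mul_le_mul_of_nonneg_left (mul_le_mul_of_nonneg_left ?_ zero_le_two) hn
        refine mul_le_mul (Finset.sum_le_sum fun a _ => ?_) (hT k (Finset.mem_range.1 hk))
          (Finset.sum_nonneg fun b _ => ?_) (Finset.sum_nonneg fun a _ => hu a)
        · split_ifs
          · exact le_rfl
          · exact hu a
        · split_ifs
          · exact hu b
          · exact le_rfl
    _ = _ := by
        rw [← mul_assoc, Finset.mul_sum]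
        refine Finset.sum_congr rfl fun k _ => ?_
        simp only [hd]
        ring

theorem sum_four_swap_right {α β : Type*} [Fintype α] [Fintype β] (H : α → β → α → β → ℝ) :
    ∑ k, ∑ t, ∑ k', ∑ t', H k t k' t' = ∑ k, ∑ t, ∑ k', ∑ t', H k t' k' t := by
  refine Finset.sum_congr rfl fun k _ => ?_
  simp_rw [Finset.sum_comm (s := (Finset.univ : Finset α)) (t := (Finset.univ : Finset β))]
  exact Finset.sum_comm

theorem sum_four_swap_left {α β : Type*} [Fintype α] [Fintype β] (H : α → β → α → β → ℝ) :
    ∑ k, ∑ t, ∑ k', ∑ t', H k t k' t' = ∑ k, ∑ t, ∑ k', ∑ t', H k' t k t' := by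
  rw [Finset.sum_comm]
  conv_rhs => rw [Finset.sum_comm]
  exact Finset.sum_congr rfl fun t _ => Finset.sum_comm

/-- The variance of a function of two independent variables is at most the sum of the expected
variances in each variable. -/
theorem sum_sq_sub_prod_le {α β : Type*} [Fintype α] [Fintype β] (u : α → ℝ) (v : β → ℝ)
    (hu : ∀ a, 0 ≤ u a) (hv : ∀ b, 0 ≤ v b) (F : α → β → ℝ) :
    ∑ k, ∑ t, ∑ k', ∑ t', (u k * v t) * (u k' * v t') * (F k t - F k' t') ^ 2 ≤
      (∑ k, u k) * ∑ k, u k * ∑ t, ∑ t', v t * v t' * (F k t - F k t') ^ 2 +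
      (∑ t, v t) * ∑ t, v t * ∑ k, ∑ k', u k * u k' * (F k t - F k' t) ^ 2 := by
  have e1 : (∑ k, u k) * ∑ k, u k * ∑ t, ∑ t', v t * v t' * (F k t - F k t') ^ 2 =
      ∑ k, ∑ t, ∑ k', ∑ t', (u k * v t) * (u k' * v t') * (F k t - F k t') ^ 2 := by
    rw [mul_comm, Finset.sum_mul]
    refine Finset.sum_congr rfl fun _ _ => ?_
    rw [mul_comm (u _), mul_assoc, Finset.sum_mul]
    refine Finset.sum_congr rfl fun _ _ => ?_
    rw [Finset.mul_sum, mul_comm, Finset.sum_mul]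
    refine Finset.sum_congr rfl fun _ _ => ?_
    rw [Finset.mul_sum]
    refine Finset.sum_congr rfl fun _ _ => ?_
    ring
  have e2 : (∑ t, v t) * ∑ t, v t * ∑ k, ∑ k', u k * u k' * (F k t - F k' t) ^ 2 =
      ∑ k, ∑ t, ∑ k', ∑ t', (u k * v t) * (u k' * v t') * (F k t - F k' t) ^ 2 := by
    conv_rhs => rw [Finset.sum_comm]
    rw [mul_comm, Finset.sum_mul]
    refine Finset.sum_congr rfl fun _ _ => ?_
    rw [mul_comm (v _), mul_assoc, Finset.sum_mul]
    refine Finset.sum_congr rfl fun _ _ => ?_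
    rw [Finset.sum_mul]
    refine Finset.sum_congr rfl fun _ _ => ?_
    rw [Finset.mul_sum, Finset.mul_sum]
    refine Finset.sum_congr rfl fun _ _ => ?_
    ring
  have e0 := sum_four_swap_right
    fun k t k' t' => (u k * v t) * (u k' * v t') * (F k t - F k' t') ^ 2
  have e1' := e1.trans (sum_four_swap_left _)
  have e2' := e2.trans (sum_four_swap_right _)
  -- Four sides minus two diagonals of the quadrilateral of values is the square of the mixed
  -- difference. Exchanging `t` and `t'` (`e0`) shows that both diagonals have the same total.
  have key : ∀ k t k' t', (u k * v t) * (u k' * v t') * (F k t - F k' t') ^ 2 +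
      (u k * v t') * (u k' * v t) * (F k t' - F k' t) ^ 2 ≤
      (u k * v t) * (u k' * v t') * (F k t - F k t') ^ 2 +
      (u k' * v t) * (u k * v t') * (F k' t - F k' t') ^ 2 +
      (u k * v t) * (u k' * v t') * (F k t - F k' t) ^ 2 +
      (u k * v t') * (u k' * v t) * (F k t' - F k' t') ^ 2 := by
    intro k t k' t'
    have := mul_nonneg (mul_nonneg (mul_nonneg (hu k) (hv t)) (mul_nonneg (hu k') (hv t')))
      (sq_nonneg (F k t - F k t' - F k' t + F k' t'))
    linarith
  have hsum : _ ≤ _ := Finset.sum_le_sum fun k (_ : k ∈ Finset.univ) => Finset.sum_le_sum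
    fun t (_ : t ∈ Finset.univ) => Finset.sum_le_sum fun k' (_ : k' ∈ Finset.univ) =>
      Finset.sum_le_sum fun t' (_ : t' ∈ Finset.univ) => key k t k' t'
  simp only [Finset.sum_add_distrib] at hsum
  linarith

/-! ### Poincaré inequality for exchanges of nested inversions -/

/-- The pairs of positions `a < c` of `σ` holding a larger and a smaller element, such that
all elements between them are smaller than both, and exchanging them does not decrease the
weight. -/
def IsNestedInversion {n : ℕ} (p : Fin n → Fin n → ℝ) (σ : Equiv.Perm (Fin n)) (a c : Fin n) :
    Prop :=
  a < c ∧ σ c < σ a ∧ (∀ m, a < m → m < c → σ m < σ c) ∧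
    permWeight p σ ≤ permWeight p (σ * Equiv.swap a c)

open scoped Classical in
/-- The Dirichlet form of the transpositions of nested inversions. -/
noncomputable def transForm {n : ℕ} (p : Fin n → Fin n → ℝ) (f : Equiv.Perm (Fin n) → ℝ) : ℝ :=
  ∑ σ : Equiv.Perm (Fin n), ∑ a, ∑ c, if IsNestedInversion p σ a c then
    permWeight p σ * (f (σ * Equiv.swap a c) - f σ) ^ 2 else 0

/-- The inserted value is the smallest, so it may stand between the two entries. Its position is
unaffected by the exchange, so both weights gain the same factor. -/
theorem IsNestedInversion.insertPerm {n : ℕ} {q : Fin (n + 1) → ℝ}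
    {p : Fin (n + 1) → Fin (n + 1) → ℝ} (h : HasWeapons q p) (hq : ∀ i, 0 < q i ∧ q i < 1)
    (k : Fin (n + 1)) {τ : Equiv.Perm (Fin n)} {a c : Fin n}
    (hac : IsNestedInversion (fun i j : Fin n => p i.succ j.succ) τ a c) :
    IsNestedInversion p (insertPerm k τ) (k.succAbove a) (k.succAbove c) := by
  obtain ⟨h1, h2, h3, h4⟩ := hac
  refine ⟨Fin.succAbove_lt_succAbove_iff.2 h1, by simpa using h2, fun m ham hmc => ?_, ?_⟩
  · rcases Fin.eq_self_or_eq_succAbove k m with rfl | ⟨j, rfl⟩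
    · simp
    · rw [Fin.succAbove_lt_succAbove_iff] at ham hmc
      simpa using h3 j ham hmc
  · rw [insertPerm_mul_swap_succAbove, permWeight_insertPerm h, permWeight_insertPerm h]
    refine mul_le_mul_of_nonneg_left h4 ?_
    have := hq 0
    exact mul_nonneg (pow_nonneg (by linarith) _) (pow_nonneg (by linarith) _)

theorem isNestedInversion_insertPerm_succ {n : ℕ} {q : Fin (n + 1) → ℝ}
    {p : Fin (n + 1) → Fin (n + 1) → ℝ} (h : HasWeapons q p)
    (hq : ∀ i, 1 / 2 ≤ q i ∧ q i < 1) (k : Fin n) (τ : Equiv.Perm (Fin n)) :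
    IsNestedInversion p (insertPerm k.succ τ) k.castSucc k.succ := by
  refine ⟨Fin.castSucc_lt_succ, ?_, fun m h1 h2 => ?_, ?_⟩
  · rw [insertPerm_self, ← Fin.succAbove_succ_self, insertPerm_succAbove]
    exact Fin.succ_pos _
  · rw [Fin.lt_def] at h1 h2
    simp at h1 h2
    omega
  · have h0 := hq 0
    rw [insertPerm_succ_mul_swap, permWeight_insertPerm h, permWeight_insertPerm h]
    refine mul_le_mul_of_nonneg_right ?_ (permWeight_pos h.succ
      (fun i => ⟨by linarith [(hq i.succ).1], (hq i.succ).2⟩) τ).le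
    have hk : n - (k : ℕ) = (n - (k + 1)) + 1 := by omega
    simp only [Fin.val_succ, Fin.val_castSucc]
    rw [hk, pow_succ, pow_succ]
    have hx : 0 ≤ (1 - q 0) ^ (k : ℕ) * q 0 ^ (n - (k + 1)) :=
      mul_nonneg (pow_nonneg (by linarith) _) (pow_nonneg (by linarith) _)
    nlinarith

/-- The nested inversions of `insertPerm k τ` include the one moving the smallest value a place left
and all those inherited from `τ`. These families are disjoint, which lets the two variance terms of
the induction be added without loss. -/
theorem transForm_succ_ge {n : ℕ} {q : Fin (n + 1) → ℝ}
    {p : Fin (n + 1) → Fin (n + 1) → ℝ} (h : HasWeapons q p)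
    (hq : ∀ i, 1 / 2 ≤ q i ∧ q i < 1) (f : Equiv.Perm (Fin (n + 1)) → ℝ) :
    (∑ τ, ∑ k : Fin n, permWeight p (insertPerm k.succ τ) *
        (f (insertPerm k.castSucc τ) - f (insertPerm k.succ τ)) ^ 2) +
      ∑ k : Fin (n + 1), (1 - q 0) ^ (k : ℕ) * q 0 ^ (n - (k : ℕ)) *
        transForm (fun i j : Fin n => p i.succ j.succ) (fun τ => f (insertPerm k τ)) ≤
      transForm p f := by
  classical
  have hq' : ∀ i, 0 < q i ∧ q i < 1 := fun i => ⟨by linarith [(hq i).1], (hq i).2⟩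
  set G : Equiv.Perm (Fin (n + 1)) → Fin (n + 1) → Fin (n + 1) → ℝ := fun σ a c =>
    if IsNestedInversion p σ a c then
    permWeight p σ * (f (σ * Equiv.swap a c) - f σ) ^ 2 else 0 with hG
  have hG0 : ∀ σ a c, 0 ≤ G σ a c := fun σ a c => by
    simp only [hG]
    split_ifs
    · exact mul_nonneg (permWeight_pos h hq' σ).le (sq_nonneg _)
    · exact le_rfl
  have e : transForm p f = ∑ k, ∑ τ, ∑ c, ∑ a, G (insertPerm k τ) a c := by
    unfold transForm
    rw [sum_perm_succ]
    exact Finset.sum_congr rfl fun k _ => Finset.sum_congr rfl fun τ _ => Finset.sum_comm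
  -- Pairs with right end `k`, plus pairs avoiding `k`; pairs with left end `k` are dropped as
  -- nonnegative.
  have split : ∀ k τ, ∑ a, G (insertPerm k τ) a k +
      ∑ c, ∑ a, G (insertPerm k τ) (k.succAbove a) (k.succAbove c) ≤
      ∑ c, ∑ a, G (insertPerm k τ) a c := fun k τ => by
    conv_rhs => rw [Fin.sum_univ_succAbove _ k]
    refine add_le_add le_rfl (Finset.sum_le_sum fun c _ => ?_)
    rw [Fin.sum_univ_succAbove _ k]
    linarith [hG0 (insertPerm k τ) k (k.succAbove c)]
  have first : (∑ τ, ∑ k : Fin n, permWeight p (insertPerm k.succ τ) *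
      (f (insertPerm k.castSucc τ) - f (insertPerm k.succ τ)) ^ 2) ≤
      ∑ k, ∑ τ, ∑ a, G (insertPerm k τ) a k := by
    rw [Finset.sum_comm, Fin.sum_univ_succ]
    have h0 : 0 ≤ ∑ τ, ∑ a, G (insertPerm 0 τ) a 0 :=
      Finset.sum_nonneg fun τ _ => Finset.sum_nonneg fun a _ => hG0 _ _ _
    refine le_add_of_nonneg_of_le h0 (Finset.sum_le_sum fun k _ => Finset.sum_le_sum fun τ _ => ?_)
    refine le_trans (le_of_eq ?_) (Finset.single_le_sum (fun a _ => hG0 _ a _)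
      (Finset.mem_univ k.castSucc))
    simp only [hG]
    rw [if_pos (isNestedInversion_insertPerm_succ h hq k τ), insertPerm_succ_mul_swap]
  have second : ∑ k : Fin (n + 1), (1 - q 0) ^ (k : ℕ) * q 0 ^ (n - (k : ℕ)) *
      transForm (fun i j : Fin n => p i.succ j.succ) (fun τ => f (insertPerm k τ)) ≤
      ∑ k, ∑ τ, ∑ c, ∑ a, G (insertPerm k τ) (k.succAbove a) (k.succAbove c) := by
    refine Finset.sum_le_sum fun k _ => ?_
    unfold transForm
    rw [Finset.mul_sum]
    refine Finset.sum_le_sum fun τ _ => ?_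
    rw [Finset.sum_comm, Finset.mul_sum]
    refine Finset.sum_le_sum fun c _ => ?_
    rw [Finset.mul_sum]
    refine Finset.sum_le_sum fun a _ => ?_
    by_cases hN : IsNestedInversion (fun i j : Fin n => p i.succ j.succ) τ a c
    · simp only [hG]
      rw [if_pos hN, if_pos (hN.insertPerm h hq' k), insertPerm_mul_swap_succAbove,
        permWeight_insertPerm h, ← mul_assoc]
    · rw [if_neg hN, mul_zero]
      exact hG0 _ _ _
  have := Finset.sum_le_sum fun k (_ : k ∈ Finset.univ) =>
    Finset.sum_le_sum fun τ (_ : τ ∈ Finset.univ) => split k τ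
  simp only [Finset.sum_add_distrib] at this
  rw [e]
  linarith

/-- Successive weights have ratio `(1 - q) / q`, so a tail is its first term times a geometric sum.
-/
theorem sum_geom_tail_le {n : ℕ} {q T : ℝ} (hq : 1 / 2 ≤ q ∧ q < 1)
    (hT : ∀ m ≤ n, ∑ j ∈ Finset.range m, ((1 - q) / q) ^ j ≤ T) {k : ℕ} (hk : k < n) :
    ∑ b ∈ Finset.range (n + 1), (if k < b then (1 - q) ^ b * q ^ (n - b) else 0) ≤
      T * ((1 - q) ^ (k + 1) * q ^ (n - (k + 1))) := by
  have hq0 : 0 < q := by linarith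
  rw [← Finset.sum_filter]
  have : (Finset.range (n + 1)).filter (fun b => k < b) = Finset.Ico (k + 1) (n + 1) := by
    ext b
    simp only [Finset.mem_filter, Finset.mem_range, Finset.mem_Ico]
    omega
  rw [this, Finset.sum_Ico_eq_sum_range]
  have hm : n + 1 - (k + 1) ≤ n := by omega
  refine le_trans (le_of_eq ?_) (mul_le_mul_of_nonneg_right (hT _ hm)
    (mul_nonneg (pow_nonneg (by linarith) _) (pow_nonneg hq0.le _)))
  rw [Finset.sum_mul]
  refine Finset.sum_congr rfl fun j hj => ?_
  have hj' := Finset.mem_range.1 hj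
  have e : n - (k + 1) = (n - (k + 1 + j)) + j := by omega
  rw [e, pow_add, pow_add _ _ j, div_pow]
  field_simp

/-- `N` is kept apart from `n` so that the constant stays the same throughout the induction:
`sum_sq_sub_prod_le` splits the variance as `transForm_succ_ge` splits the form. -/
theorem poincare_transForm (N : ℕ) (T : ℝ) (n : ℕ) (hn : n ≤ N) (q : Fin n → ℝ)
    (p : Fin n → Fin n → ℝ) (h : HasWeapons q p) (hq : ∀ i, 1 / 2 ≤ q i ∧ q i < 1)
    (hT : ∀ i, ∀ m ≤ N, ∑ j ∈ Finset.range m, ((1 - q i) / q i) ^ j ≤ T) (hT0 : 0 ≤ T)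
    (f : Equiv.Perm (Fin n) → ℝ) :
    ∑ σ, ∑ ρ, permWeight p σ * permWeight p ρ * (f σ - f ρ) ^ 2 ≤
      2 * (∑ σ, permWeight p σ) * (N * T) * transForm p f := by
  classical
  induction n with
  | zero => simp [transForm]
  | succ n ih =>
    have hq' : ∀ i, 0 < q i ∧ q i < 1 := fun i => ⟨by linarith [(hq i).1], (hq i).2⟩
    set p' : Fin n → Fin n → ℝ := fun i j => p i.succ j.succ with hp'
    set v : Equiv.Perm (Fin n) → ℝ := permWeight p' with hv
    set u : Fin (n + 1) → ℝ := fun k => (1 - q 0) ^ (k : ℕ) * q 0 ^ (n - (k : ℕ)) with hu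
    set F : Fin (n + 1) → Equiv.Perm (Fin n) → ℝ := fun k τ => f (insertPerm k τ) with hF
    have hw : ∀ k τ, permWeight p (insertPerm k τ) = u k * v τ := permWeight_insertPerm h
    have hv0 : ∀ τ, 0 ≤ v τ := fun τ => (permWeight_pos h.succ (fun i => hq' i.succ) τ).le
    have hu0 : ∀ k, 0 ≤ u k := fun k => mul_nonneg
      (pow_nonneg (by linarith [(hq' 0).2]) _) (pow_nonneg (hq' 0).1.le _)
    have hU0 : 0 ≤ ∑ k, u k := Finset.sum_nonneg fun k _ => hu0 k
    have hV0 : 0 ≤ ∑ τ, v τ := Finset.sum_nonneg fun k _ => hv0 k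
    have hN : 0 ≤ (N : ℝ) * T := mul_nonneg (Nat.cast_nonneg _) hT0
    have eZ : ∑ σ, permWeight p σ = (∑ k, u k) * ∑ τ, v τ := by
      rw [sum_perm_succ, Finset.sum_mul_sum]
      simp_rw [hw]
    have eL : ∑ σ, ∑ ρ, permWeight p σ * permWeight p ρ * (f σ - f ρ) ^ 2 =
        ∑ k, ∑ t, ∑ k', ∑ t', (u k * v t) * (u k' * v t') * (F k t - F k' t') ^ 2 := by
      rw [sum_perm_succ]
      simp_rw [sum_perm_succ, hw]
      rfl
    have hA : ∀ k, ∑ t, ∑ t', v t * v t' * (F k t - F k t') ^ 2 ≤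
        2 * (∑ t, v t) * (N * T) * transForm p' (F k) := fun k =>
      ih (by omega) _ p' h.succ (fun i => hq i.succ) (fun i => hT i.succ) (F k)
    have hB : ∀ t, ∑ k, ∑ k', u k * u k' * (F k t - F k' t) ^ 2 ≤
        2 * (∑ k, u k) * (N * T) *
          ∑ k : Fin n, u k.succ * (F k.castSucc t - F k.succ t) ^ 2 := by
      intro t
      set g : ℕ → ℝ := fun k => if hk : k < n + 1 then F ⟨k, hk⟩ t else 0 with hg
      set u' : ℕ → ℝ := fun k => (1 - q 0) ^ k * q 0 ^ (n - k) with hu'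
      have hgk : ∀ k : Fin (n + 1), F k t = g k := fun k => by
        simp only [hg]
        rw [dif_pos k.2]
      have huk : ∀ k : Fin (n + 1), u k = u' k := fun k => rfl
      have := sum_sum_sq_sub_le n u' g T (fun k => mul_nonneg
        (pow_nonneg (by linarith [(hq' 0).2]) _) (pow_nonneg (hq' 0).1.le _))
        (fun k hk => sum_geom_tail_le (hq 0) (fun m hm => hT 0 m (by omega)) hk)
      simp_rw [hgk, huk, Fin.val_succ, Fin.val_castSucc]
      rw [Fin.sum_univ_eq_sum_range (fun k => u' k),
        Fin.sum_univ_eq_sum_range (fun k => ∑ k' : Fin (n + 1), u' k * u' k' * (g k - g k') ^ 2),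
        Fin.sum_univ_eq_sum_range
          (fun k => u' (k + 1) * (g k - g (k + 1)) ^ 2) n]
      have hin : ∀ k, ∑ k' : Fin (n + 1), u' k * u' k' * (g k - g k') ^ 2 =
          ∑ k' ∈ Finset.range (n + 1), u' k * u' k' * (g k - g k') ^ 2 := fun k =>
        Fin.sum_univ_eq_sum_range (fun k' => u' k * u' k' * (g k - g k') ^ 2) _
      simp_rw [hin]
      refine this.trans ?_
      rw [mul_assoc (2 * _)]
      refine mul_le_mul_of_nonneg_left ?_ ?_
      · simp_rw [sub_sq_comm (g _) (g (_ + 1))]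
        refine mul_le_mul_of_nonneg_right (mul_le_mul_of_nonneg_right ?_ hT0)
          (Finset.sum_nonneg fun k _ => mul_nonneg (mul_nonneg
        (pow_nonneg (by linarith [(hq' 0).2]) _) (pow_nonneg (hq' 0).1.le _)) (sq_nonneg _))
        exact_mod_cast (by omega : n ≤ N)
      · have := hU0
        simp_rw [huk] at this
        rw [Fin.sum_univ_eq_sum_range (fun k => u' k)] at this
        linarith
    rw [eL, eZ]
    refine (sum_sq_sub_prod_le u v hu0 hv0 F).trans ?_
    have h1 : ∑ k, u k * ∑ t, ∑ t', v t * v t' * (F k t - F k t') ^ 2 ≤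
        2 * (∑ t, v t) * (N * T) * ∑ k, u k * transForm p' (F k) := by
      rw [Finset.mul_sum]
      refine Finset.sum_le_sum fun k _ => ?_
      refine (mul_le_mul_of_nonneg_left (hA k) (hu0 k)).trans (le_of_eq ?_)
      ring
    have h2 : ∑ t, v t * ∑ k, ∑ k', u k * u k' * (F k t - F k' t) ^ 2 ≤
        2 * (∑ k, u k) * (N * T) * ∑ t, ∑ k : Fin n, permWeight p (insertPerm k.succ t) *
          (f (insertPerm k.castSucc t) - f (insertPerm k.succ t)) ^ 2 := by
      rw [Finset.mul_sum]
      refine Finset.sum_le_sum fun t _ => ?_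
      refine (mul_le_mul_of_nonneg_left (hB t) (hv0 t)).trans (le_of_eq ?_)
      simp_rw [hw, mul_comm (u _) (v t), mul_assoc (v t), ← Finset.mul_sum]
      ring
    have h3 := transForm_succ_ge h hq f
    have h4 := mul_le_mul_of_nonneg_left h1 hU0
    have h5 := mul_le_mul_of_nonneg_left h2 hV0
    have h6 := mul_le_mul_of_nonneg_left h3
      (mul_nonneg (mul_nonneg (mul_nonneg zero_le_two hU0) hV0) hN)
    refine (add_le_add h4 h5).trans (le_trans (le_of_eq ?_) (h6.trans (le_of_eq ?_)))
    · ring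
    · ring

/-! ### Comparison with adjacent transpositions -/

/-- The permutation moving the entry at position `a` to position `a + k` by adjacent
transpositions. -/
def moveRight {n : ℕ} (a : ℕ) : ∀ k : ℕ, a + k < n → Equiv.Perm (Fin n)
  | 0, _ => 1
  | k + 1, h => moveRight a k (by omega) * Equiv.swap ⟨a + k, by omega⟩ ⟨a + (k + 1), h⟩

theorem moveRight_apply_last {n : ℕ} (a : ℕ) : ∀ (k : ℕ) (h : a + k < n),
    moveRight a k h ⟨a + k, h⟩ = ⟨a, by omega⟩
  | 0, _ => rfl
  | k + 1, h => by
    rw [moveRight, Equiv.Perm.mul_apply, Equiv.swap_apply_right, moveRight_apply_last a k]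

theorem moveRight_apply_of_lt {n : ℕ} (a : ℕ) : ∀ (k : ℕ) (h : a + k < n) (m : Fin n),
    a + k < m → moveRight a k h m = m
  | 0, _, _, _ => rfl
  | k + 1, h, m, hm => by
    rw [moveRight, Equiv.Perm.mul_apply, Equiv.swap_apply_of_ne_of_ne,
      moveRight_apply_of_lt a k _ m (by omega)]
    · exact fun e => by simp [e] at hm
    · exact fun e => by simp [e] at hm

/-- This makes the paths starting at `σ` and at `σ * swap` meet at the same permutation. -/
theorem swap_mul_moveRight {n : ℕ} (a k : ℕ) (h : a + (k + 1) < n) :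
    Equiv.swap ⟨a, by omega⟩ ⟨a + (k + 1), h⟩ * moveRight a k (by omega) =
      moveRight a (k + 1) h := by
  rw [moveRight, Equiv.mul_swap_eq_swap_mul, moveRight_apply_last,
    moveRight_apply_of_lt _ _ _ _ (by simp)]

/-- Detailed balance without division: an adjacent swap changes the relative order of no other pair,
so the two products agree factor by factor over ordered pairs of positions. -/
theorem permWeight_mul_swap_adjacent {n : ℕ} (p : Fin n → Fin n → ℝ) (σ : Equiv.Perm (Fin n)) (e : Fin (n - 1)) :
    permWeight p (σ * Equiv.swap (leftPos e) (rightPos e)) *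
        p (σ (leftPos e)) (σ (rightPos e)) =
      permWeight p σ * p (σ (rightPos e)) (σ (leftPos e)) := by
  set l : Fin n := leftPos e with hl
  set r : Fin n := rightPos e with hr
  have hlr : (r : ℕ) = l + 1 := rfl
  set P : Fin n × Fin n → ℝ := fun x => p (σ x.1) (σ x.2) with hP
  have e1 : permWeight p (σ * Equiv.swap l r) = ∏ x : Fin n × Fin n,
      if Equiv.swap l r x.1 < Equiv.swap l r x.2 then P x else 1 := by
    rw [permWeight_eq_prod_ite, Fintype.prod_prod_type]
    rw [← Equiv.prod_comp (Equiv.swap l r)]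
    refine Finset.prod_congr rfl fun i _ => ?_
    rw [← Equiv.prod_comp (Equiv.swap l r)]
    simp [hP]
  have e2 : permWeight p σ = ∏ x : Fin n × Fin n, if x.1 < x.2 then P x else 1 := by
    rw [permWeight_eq_prod_ite, Fintype.prod_prod_type]
  have e3 : p (σ l) (σ r) = ∏ x : Fin n × Fin n, if x = (l, r) then P x else 1 := by
    simp [hP]
  have e4 : p (σ r) (σ l) = ∏ x : Fin n × Fin n, if x = (r, l) then P x else 1 := by
    simp [hP]
  rw [e1, e2, e3, e4, ← Finset.prod_mul_distrib, ← Finset.prod_mul_distrib]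
  refine Finset.prod_congr rfl fun x _ => ?_
  obtain ⟨i, j⟩ := x
  simp only [Prod.mk.injEq, Equiv.swap_apply_def, Fin.ext_iff, Fin.lt_def]
  split_ifs <;> first | omega | simp

/-- The Dirichlet form of the exchange of positions `e` and `e + 1`. -/
noncomputable def edgeForm {n : ℕ} (p : Fin n → Fin n → ℝ) (e : Fin (n - 1))
    (f : Equiv.Perm (Fin n) → ℝ) : ℝ :=
  ∑ σ : Equiv.Perm (Fin n), if σ (rightPos e) < σ (leftPos e) then
    permWeight p σ * (f (σ * Equiv.swap (leftPos e) (rightPos e)) - f σ) ^ 2 else 0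

theorem edgeForm_nonneg {n : ℕ} {q : Fin n → ℝ} {p : Fin n → Fin n → ℝ}
    (h : HasWeapons q p) (hq : ∀ i, 0 < q i ∧ q i < 1) (e : Fin (n - 1))
    (f : Equiv.Perm (Fin n) → ℝ) : 0 ≤ edgeForm p e f := by
  refine Finset.sum_nonneg fun σ _ => ?_
  split_ifs
  · exact mul_nonneg (permWeight_pos h hq σ).le (sq_nonneg _)
  · exact le_rfl

theorem permWeight_le_of_inversion {n : ℕ} {q : Fin n → ℝ} {p : Fin n → Fin n → ℝ}
    (h : HasWeapons q p) (hq : ∀ i, 1 / 2 ≤ q i ∧ q i < 1) (σ : Equiv.Perm (Fin n))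
    (e : Fin (n - 1)) (he : σ (rightPos e) < σ (leftPos e)) :
    permWeight p σ ≤ permWeight p (σ * Equiv.swap (leftPos e) (rightPos e)) := by
  have hq' : ∀ i, 0 < q i ∧ q i < 1 := fun i => ⟨by linarith [(hq i).1], (hq i).2⟩
  have h1 := permWeight_mul_swap_adjacent p σ e
  obtain ⟨h2, h3⟩ := h _ _ he
  rw [h2, h3] at h1
  have h4 := permWeight_pos h hq' σ
  have h5 := permWeight_pos h hq' (σ * Equiv.swap (leftPos e) (rightPos e))
  have h6 := hq (σ (rightPos e))
  by_contra! hlt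
  nlinarith

/-- The entry at position `a` of `σ` exceeds the next `k` entries. -/
def IsDescending {n : ℕ} (σ : Equiv.Perm (Fin n)) (a k : ℕ) : Prop :=
  ∀ (x m : Fin n), (x : ℕ) = a → a < m → (m : ℕ) ≤ a + k → σ m < σ x

theorem moveRight_succ_eq {n : ℕ} (a k : ℕ) (h : a + (k + 1) < n) :
    moveRight a (k + 1) h = moveRight a k (by omega) *
      Equiv.swap (leftPos ⟨a + k, by omega⟩) (rightPos ⟨a + k, by omega⟩) := rfl

theorem IsDescending.inversion {n : ℕ} {σ : Equiv.Perm (Fin n)} {a k : ℕ}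
    (h : a + (k + 1) < n) (hσ : IsDescending σ a (k + 1)) :
    (σ * moveRight a k (by omega) : Equiv.Perm (Fin n)) (rightPos ⟨a + k, by omega⟩) <
      (σ * moveRight a k (by omega) : Equiv.Perm (Fin n)) (leftPos ⟨a + k, by omega⟩) := by
  have e1 : moveRight (n := n) a k (by omega) (leftPos ⟨a + k, by omega⟩) = ⟨a, by omega⟩ :=
    moveRight_apply_last a k (by omega)
  have e2 : moveRight (n := n) a k (by omega) (rightPos ⟨a + k, by omega⟩) =
      rightPos ⟨a + k, by omega⟩ :=
    moveRight_apply_of_lt a k (by omega) _ (by simp [rightPos])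
  rw [Equiv.Perm.mul_apply, Equiv.Perm.mul_apply, e1, e2]
  exact hσ _ _ rfl (by simp only [rightPos]; omega) (by simp only [rightPos]; omega)

theorem IsDescending.mono {n : ℕ} {σ : Equiv.Perm (Fin n)} {a k l : ℕ}
    (hσ : IsDescending σ a k) (hl : l ≤ k) : IsDescending σ a l :=
  fun x m hx h1 h2 => hσ x m hx h1 (by omega)

theorem permWeight_le_moveRight {n : ℕ} {q : Fin n → ℝ} {p : Fin n → Fin n → ℝ}
    (h : HasWeapons q p) (hq : ∀ i, 1 / 2 ≤ q i ∧ q i < 1) {σ : Equiv.Perm (Fin n)} {a : ℕ} :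
    ∀ (k : ℕ) (hk : a + k < n), IsDescending σ a k →
      permWeight p σ ≤ permWeight p (σ * moveRight a k hk)
  | 0, _, _ => by simp [moveRight]
  | k + 1, hk, hσ => by
    refine (permWeight_le_moveRight h hq k (by omega) (hσ.mono (Nat.le_succ k))).trans ?_
    rw [moveRight_succ_eq, ← mul_assoc]
    exact permWeight_le_of_inversion h hq _ _ (hσ.inversion hk)

/-- The sum over all adjacent exchanges of their Dirichlet forms. -/
noncomputable def totalEdgeForm {n : ℕ} (p : Fin n → Fin n → ℝ)
    (f : Equiv.Perm (Fin n) → ℝ) : ℝ := ∑ e, edgeForm p e f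

/-- One step of the path `σ * moveRight a j`. -/
theorem sum_moveRight_step_le {n : ℕ} {q : Fin n → ℝ} {p : Fin n → Fin n → ℝ}
    (h : HasWeapons q p) (hq : ∀ i, 1 / 2 ≤ q i ∧ q i < 1) (f : Equiv.Perm (Fin n) → ℝ)
    (a k : ℕ) (hk : a + (k + 1) < n) (S : Finset (Equiv.Perm (Fin n)))
    (hS : ∀ σ ∈ S, IsDescending σ a (k + 1)) :
    ∑ σ ∈ S, permWeight p σ *
        (f (σ * moveRight a (k + 1) hk) - f (σ * moveRight a k (by omega))) ^ 2 ≤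
      edgeForm p ⟨a + k, by omega⟩ f := by
  have hq' : ∀ i, 0 < q i ∧ q i < 1 := fun i => ⟨by linarith [(hq i).1], (hq i).2⟩
  set M : Equiv.Perm (Fin n) := moveRight a k (by omega) with hM
  set e : Fin (n - 1) := ⟨a + k, by omega⟩ with he
  set g : Equiv.Perm (Fin n) → ℝ := fun τ => if τ (rightPos e) < τ (leftPos e) then
    permWeight p τ * (f (τ * Equiv.swap (leftPos e) (rightPos e)) - f τ) ^ 2 else 0 with hg
  have hg0 : ∀ τ, 0 ≤ g τ := fun τ => by
    simp only [hg]
    split_ifs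
    · exact mul_nonneg (permWeight_pos h hq' _).le (sq_nonneg _)
    · exact le_rfl
  -- Right translation by `M` is a bijection, so distinct `σ` use distinct exchanges and there is no
  -- congestion.
  have hsum : edgeForm p e f = ∑ σ, g (σ * M) := (Equiv.sum_comp (Equiv.mulRight M) g).symm
  rw [hsum]
  refine le_trans (Finset.sum_le_sum fun σ hσ => ?_)
    (Finset.sum_le_sum_of_subset_of_nonneg (Finset.subset_univ S) fun σ _ _ => hg0 (σ * M))
  simp only [hg]
  rw [if_pos ((hS σ hσ).inversion hk), moveRight_succ_eq, ← mul_assoc]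
  exact mul_le_mul_of_nonneg_right (permWeight_le_moveRight h hq k _
    ((hS σ hσ).mono (Nat.le_succ k))) (sq_nonneg _)

/-- Cauchy–Schwarz costs the path length `k ≤ n`. The steps use distinct edges, so their forms add
up to at most `totalEdgeForm`. -/
theorem sum_moveRight_le {n : ℕ} {q : Fin n → ℝ} {p : Fin n → Fin n → ℝ}
    (h : HasWeapons q p) (hq : ∀ i, 1 / 2 ≤ q i ∧ q i < 1) (f : Equiv.Perm (Fin n) → ℝ)
    (a : ℕ) (k : ℕ) (hk : a + k < n) (S : Finset (Equiv.Perm (Fin n)))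
    (hS : ∀ σ ∈ S, IsDescending σ a k) :
    ∑ σ ∈ S, permWeight p σ * (f (σ * moveRight a k hk) - f σ) ^ 2 ≤
      n * totalEdgeForm p f := by
  have hq' : ∀ i, 0 < q i ∧ q i < 1 := fun i => ⟨by linarith [(hq i).1], (hq i).2⟩
  set M : ℕ → Equiv.Perm (Fin n) := fun j => if hj : a + j < n then moveRight a j hj else 1
    with hM
  have hMj : ∀ j (hj : a + j < n), M j = moveRight a j hj := fun j hj => dif_pos hj
  have hM0 : M 0 = 1 := by rw [hMj 0 (by omega)]; rfl
  have step : ∀ σ ∈ S, permWeight p σ * (f (σ * moveRight a k hk) - f σ) ^ 2 ≤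
      k * ∑ j ∈ Finset.range k, permWeight p σ * (f (σ * M (j + 1)) - f (σ * M j)) ^ 2 := by
    intro σ _
    have e : f (σ * moveRight a k hk) - f σ =
        ∑ j ∈ Finset.range k, (f (σ * M (j + 1)) - f (σ * M j)) := by
      rw [Finset.sum_range_sub (fun j => f (σ * M j)), hM0, hMj k hk, mul_one]
    have := sq_sum_le_card_mul_sum_sq (s := Finset.range k)
      (f := fun j => f (σ * M (j + 1)) - f (σ * M j))
    rw [Finset.card_range] at this
    rw [e, ← Finset.mul_sum]
    refine (mul_le_mul_of_nonneg_left this (permWeight_pos h hq' σ).le).trans (le_of_eq ?_)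
    ring
  refine (Finset.sum_le_sum step).trans ?_
  rw [← Finset.mul_sum, Finset.sum_comm]
  have hsum : ∑ j ∈ Finset.range k, ∑ σ ∈ S,
      permWeight p σ * (f (σ * M (j + 1)) - f (σ * M j)) ^ 2 ≤ totalEdgeForm p f := by
    have hle : ∀ j : Fin k, ∑ σ ∈ S,
        permWeight p σ * (f (σ * M (j + 1)) - f (σ * M j)) ^ 2 ≤
        edgeForm p ⟨a + j, by omega⟩ f := fun j => by
      rw [hMj j (by omega), hMj (j + 1) (by omega)]
      exact sum_moveRight_step_le h hq f a j (by omega) S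
        fun σ hσ => (hS σ hσ).mono (by omega)
    rw [← Fin.sum_univ_eq_sum_range
      (fun j => ∑ σ ∈ S, permWeight p σ * (f (σ * M (j + 1)) - f (σ * M j)) ^ 2)]
    refine (Finset.sum_le_sum fun j _ => hle j).trans ?_
    have hinj : Function.Injective (fun j : Fin k => (⟨a + j, by omega⟩ : Fin (n - 1))) := by
      intro i j hij
      simpa [Fin.ext_iff] using hij
    rw [← Finset.sum_image (g := fun j : Fin k => (⟨a + j, by omega⟩ : Fin (n - 1)))
      (f := fun e => edgeForm p e f) (fun i _ j _ hij => hinj hij)]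
    exact Finset.sum_le_sum_of_subset_of_nonneg (Finset.subset_univ _)
      fun e _ _ => edgeForm_nonneg h hq' e f
  have h0 : 0 ≤ totalEdgeForm p f := Finset.sum_nonneg fun e _ => edgeForm_nonneg h hq' e f
  refine (mul_le_mul_of_nonneg_left hsum (Nat.cast_nonneg k)).trans ?_
  refine mul_le_mul_of_nonneg_right ?_ h0
  exact_mod_cast (by omega : k ≤ n)

/-- Moving `σ a` right to position `c` sorts an inversion at each step, since it exceeds all entries
passed. After the exchange, `σ c` stands at `a` and can be moved right in the same way to just
before `c`, giving the same permutation. Both paths go up in weight, and the exchange itself does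
not decrease it. -/
theorem sum_nestedInversion_le {n : ℕ} {q : Fin n → ℝ} {p : Fin n → Fin n → ℝ}
    (h : HasWeapons q p) (hq : ∀ i, 1 / 2 ≤ q i ∧ q i < 1) (f : Equiv.Perm (Fin n) → ℝ)
    (a c : Fin n) (S : Finset (Equiv.Perm (Fin n)))
    (hS : ∀ σ ∈ S, IsNestedInversion p σ a c) :
    ∑ σ ∈ S, permWeight p σ * (f (σ * Equiv.swap a c) - f σ) ^ 2 ≤
      4 * n * totalEdgeForm p f := by
  classical
  have hq' : ∀ i, 0 < q i ∧ q i < 1 := fun i => ⟨by linarith [(hq i).1], (hq i).2⟩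
  rcases S.eq_empty_or_nonempty with rfl | ⟨σ₀, hσ₀⟩
  · rw [Finset.sum_empty]
    exact mul_nonneg (by positivity) (Finset.sum_nonneg fun e _ => edgeForm_nonneg h hq' e f)
  -- `k` counts the positions strictly between `a` and `c`.
  obtain ⟨k, hk⟩ := Nat.exists_eq_add_of_lt (hS σ₀ hσ₀).1
  have hlt : (a : ℕ) + (k + 1) < n := by omega
  have hc : c = ⟨a + (k + 1), hlt⟩ := Fin.ext (by simp; omega)
  have hM : Equiv.swap a c * moveRight a k (by omega) = moveRight a (k + 1) hlt := by
    rw [← swap_mul_moveRight]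
    exact congrArg (fun x => Equiv.swap a x * moveRight a k (by omega)) hc
  have d1 : ∀ σ ∈ S, IsDescending σ a (k + 1) := by
    intro σ hσ x m hx h1 h2
    obtain ⟨-, g2, g3, -⟩ := hS σ hσ
    obtain rfl : x = a := Fin.ext hx
    rcases eq_or_ne m c with rfl | hmc
    · exact g2
    · refine (g3 m h1 ?_).trans g2
      rw [Fin.lt_def]
      have : (m : ℕ) ≠ c := fun e => hmc (Fin.ext e)
      omega
  have d2 : ∀ ρ ∈ S.image (fun σ => σ * Equiv.swap a c), IsDescending ρ a k := by
    intro ρ hρ x m hx h1 h2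
    obtain ⟨σ, hσ, rfl⟩ := Finset.mem_image.1 hρ
    obtain ⟨-, g2, g3, -⟩ := hS σ hσ
    obtain rfl : x = a := Fin.ext hx
    have hmc : m < c := by rw [Fin.lt_def]; omega
    have hxm : x < m := h1
    rw [Equiv.Perm.mul_apply, Equiv.Perm.mul_apply, Equiv.swap_apply_left,
      Equiv.swap_apply_of_ne_of_ne hxm.ne' hmc.ne]
    exact g3 m h1 hmc
  have b1 := sum_moveRight_le h hq f a (k + 1) hlt S d1
  have b2 := sum_moveRight_le h hq f a k (by omega) _ d2
  rw [Finset.sum_image fun σ _ σ' _ e => mul_right_cancel e] at b2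
  simp only [mul_assoc _ (Equiv.swap a c) (moveRight _ _ _), hM] at b2
  -- The square of a difference of two terms is at most twice the sum of their squares; with one
  -- path for each term this yields the constant `4`.
  have : ∀ σ ∈ S, permWeight p σ * (f (σ * Equiv.swap a c) - f σ) ^ 2 ≤
      2 * (permWeight p σ * (f (σ * moveRight a (k + 1) hlt) - f σ) ^ 2) +
      2 * (permWeight p (σ * Equiv.swap a c) *
        (f (σ * moveRight a (k + 1) hlt) - f (σ * Equiv.swap a c)) ^ 2) := by
    intro σ hσ
    obtain ⟨-, -, -, g4⟩ := hS σ hσ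
    have w0 := (permWeight_pos h hq' σ).le
    set x := f (σ * moveRight a (k + 1) hlt)
    set y := f (σ * Equiv.swap a c)
    have t1 := mul_le_mul_of_nonneg_right g4 (sq_nonneg (x - y))
    have t2 := mul_nonneg w0 (sq_nonneg ((x - f σ) + (x - y)))
    linarith
  refine (Finset.sum_le_sum this).trans ?_
  rw [Finset.sum_add_distrib, ← Finset.mul_sum, ← Finset.mul_sum]
  linarith

theorem transForm_le {n : ℕ} {q : Fin n → ℝ} {p : Fin n → Fin n → ℝ}
    (h : HasWeapons q p) (hq : ∀ i, 1 / 2 ≤ q i ∧ q i < 1) (f : Equiv.Perm (Fin n) → ℝ) :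
    transForm p f ≤ 4 * (n : ℝ) ^ 3 * totalEdgeForm p f := by
  classical
  unfold transForm
  rw [Finset.sum_comm]
  have : ∀ a c : Fin n, (∑ σ : Equiv.Perm (Fin n), if IsNestedInversion p σ a c then
      permWeight p σ * (f (σ * Equiv.swap a c) - f σ) ^ 2 else 0) ≤
      4 * n * totalEdgeForm p f := by
    intro a c
    rw [← Finset.sum_filter]
    exact sum_nestedInversion_le h hq f a c _ fun σ hσ => (Finset.mem_filter.1 hσ).2
  calc _ ≤ ∑ a : Fin n, ∑ c : Fin n, 4 * n * totalEdgeForm p f := by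
        refine Finset.sum_le_sum fun a _ => ?_
        rw [Finset.sum_comm]
        exact Finset.sum_le_sum fun c _ => this a c
    _ = _ := by
        simp
        ring

/-! ### Contraction of the second moment -/

/-- Resampling the order of the entries at positions `e` and `e + 1`. -/
def edgeUpdate {n : ℕ} (p : Fin n → Fin n → ℝ) (e : Fin (n - 1))
    (f : Equiv.Perm (Fin n) → ℝ) (σ : Equiv.Perm (Fin n)) : ℝ :=
  f σ + p (σ (rightPos e)) (σ (leftPos e)) *
    (f (σ * Equiv.swap (leftPos e) (rightPos e)) - f σ)

theorem leftPos_lt_rightPos {n : ℕ} (e : Fin (n - 1)) : leftPos e < rightPos e := by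
  simp [leftPos, rightPos, Fin.lt_def]

theorem HasWeapons.add_eq_one {n : ℕ} {q : Fin n → ℝ} {p : Fin n → Fin n → ℝ}
    (h : HasWeapons q p) {i j : Fin n} (hij : i ≠ j) : p i j + p j i = 1 := by
  rcases lt_or_gt_of_ne hij with hl | hl
  · rw [(h _ _ hl).1, (h _ _ hl).2]
    ring
  · rw [(h _ _ hl).1, (h _ _ hl).2]
    ring

theorem nnChain_mulVec {n : ℕ} {q : Fin n → ℝ} {p : Fin n → Fin n → ℝ}
    (h : HasWeapons q p) (f : Equiv.Perm (Fin n) → ℝ) (σ : Equiv.Perm (Fin n)) :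
    (nnChain p).mulVec f σ = 1 / ((n - 1 : ℕ) : ℝ) * ∑ e, edgeUpdate p e f σ := by
  unfold Matrix.mulVec dotProduct nnChain
  simp_rw [Finset.sum_mul]
  rw [Finset.sum_comm, Finset.mul_sum]
  refine Finset.sum_congr rfl fun e _ => ?_
  simp_rw [mul_assoc, ← Finset.mul_sum, add_mul, Finset.sum_add_distrib, ite_mul, zero_mul,
    Finset.sum_ite_eq']
  simp only [Finset.mem_univ, if_true, edgeUpdate]
  have := h.add_eq_one (σ.injective.ne (leftPos_lt_rightPos e).ne)
  rw [eq_sub_of_add_eq this]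
  ring

/-- The second moment of `f` for the unnormalized weights. -/
def sqMoment {n : ℕ} (p : Fin n → Fin n → ℝ) (f : Equiv.Perm (Fin n) → ℝ) : ℝ :=
  ∑ σ, permWeight p σ * f σ ^ 2

/-- Two permutations exchanged by an adjacent swap: detailed balance. -/
theorem edgeUpdate_pair {n : ℕ} {q : Fin n → ℝ} {p : Fin n → Fin n → ℝ}
    (h : HasWeapons q p) (σ : Equiv.Perm (Fin n)) (e : Fin (n - 1)) :
    permWeight p (σ * Equiv.swap (leftPos e) (rightPos e)) *
        p (σ (leftPos e)) (σ (rightPos e)) =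
      permWeight p σ * p (σ (rightPos e)) (σ (leftPos e)) ∧
    p (σ (leftPos e)) (σ (rightPos e)) + p (σ (rightPos e)) (σ (leftPos e)) = 1 :=
  ⟨permWeight_mul_swap_adjacent p σ e,
    h.add_eq_one (σ.injective.ne (leftPos_lt_rightPos e).ne)⟩

theorem edgeUpdate_mul_swap {n : ℕ} (p : Fin n → Fin n → ℝ) (e : Fin (n - 1))
    (f : Equiv.Perm (Fin n) → ℝ) (σ : Equiv.Perm (Fin n)) :
    edgeUpdate p e f (σ * Equiv.swap (leftPos e) (rightPos e)) =
      f (σ * Equiv.swap (leftPos e) (rightPos e)) + p (σ (leftPos e)) (σ (rightPos e)) *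
        (f σ - f (σ * Equiv.swap (leftPos e) (rightPos e))) := by
  simp [edgeUpdate, mul_assoc]

theorem two_mul_sum_perm {n : ℕ} (s : Equiv.Perm (Fin n)) (g : Equiv.Perm (Fin n) → ℝ) :
    2 * ∑ σ, g σ = ∑ σ, (g σ + g (σ * s)) := by
  rw [Finset.sum_add_distrib, two_mul]
  exact congrArg _ (Equiv.sum_comp (Equiv.mulRight s) g).symm

theorem sum_edgeUpdate {n : ℕ} {q : Fin n → ℝ} {p : Fin n → Fin n → ℝ}
    (h : HasWeapons q p) (e : Fin (n - 1)) (f : Equiv.Perm (Fin n) → ℝ) :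
    ∑ σ, permWeight p σ * edgeUpdate p e f σ = ∑ σ, permWeight p σ * f σ := by
  refine mul_left_cancel₀ (two_ne_zero (α := ℝ)) ?_
  rw [two_mul_sum_perm (Equiv.swap (leftPos e) (rightPos e)),
    two_mul_sum_perm (Equiv.swap (leftPos e) (rightPos e))]
  refine Finset.sum_congr rfl fun σ _ => ?_
  obtain ⟨h1, -⟩ := edgeUpdate_pair h σ e
  rw [edgeUpdate_mul_swap]
  unfold edgeUpdate
  linear_combination (f σ - f (σ * Equiv.swap (leftPos e) (rightPos e))) * h1

/-- The update averages over the pair `{σ, σ'}`, so the loss is a conditional variance. By detailed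
balance it is the weight of the inverted member times its swap probability, which is at least `1 /
2`, times the squared difference. -/
theorem sqMoment_edgeUpdate_le {n : ℕ} {q : Fin n → ℝ} {p : Fin n → Fin n → ℝ}
    (h : HasWeapons q p) (hq : ∀ i, 1 / 2 ≤ q i ∧ q i < 1) (e : Fin (n - 1))
    (f : Equiv.Perm (Fin n) → ℝ) :
    sqMoment p (edgeUpdate p e f) ≤ sqMoment p f - 1 / 2 * edgeForm p e f := by
  have hq' : ∀ i, 0 < q i ∧ q i < 1 := fun i => ⟨by linarith [(hq i).1], (hq i).2⟩
  have key : 2 * sqMoment p (edgeUpdate p e f) ≤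
      2 * sqMoment p f - 1 / 2 * (2 * edgeForm p e f) := by
    unfold sqMoment edgeForm
    -- Doubling each sum pairs every `σ` with its swap, so the inequality can be checked pair by
    -- pair.
    rw [two_mul_sum_perm (Equiv.swap (leftPos e) (rightPos e)),
      two_mul_sum_perm (Equiv.swap (leftPos e) (rightPos e)),
      two_mul_sum_perm (Equiv.swap (leftPos e) (rightPos e)), Finset.mul_sum,
      ← Finset.sum_sub_distrib]
    refine Finset.sum_le_sum fun σ _ => ?_
    obtain ⟨h1, h2⟩ := edgeUpdate_pair h σ e
    have w1 := permWeight_pos h hq' σ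
    have w2 := permWeight_pos h hq' (σ * Equiv.swap (leftPos e) (rightPos e))
    rw [edgeUpdate_mul_swap]
    unfold edgeUpdate
    rw [Equiv.Perm.mul_apply, Equiv.Perm.mul_apply, Equiv.swap_apply_left,
      Equiv.swap_apply_right, mul_assoc σ, Equiv.swap_mul_self, mul_one]
    have hne := σ.injective.ne (leftPos_lt_rightPos e).ne
    set σ' := σ * Equiv.swap (leftPos e) (rightPos e)
    set d := f σ' - f σ with hd
    set x := p (σ (rightPos e)) (σ (leftPos e)) with hx
    set y := p (σ (leftPos e)) (σ (rightPos e)) with hy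
    have hd2 := sq_nonneg d
    have main : permWeight p σ * (f σ + x * d) ^ 2 +
        permWeight p σ' * (f σ' + y * (f σ - f σ')) ^ 2 =
        permWeight p σ * f σ ^ 2 + permWeight p σ' * f σ' ^ 2 -
          permWeight p σ * x * d ^ 2 := by
      have e1 : f σ' = f σ + d := by rw [hd]; ring
      rw [e1]
      have : permWeight p σ' * y = permWeight p σ * x := h1
      linear_combination (-2 * (f σ + d) * d + y * d ^ 2) * this +
        permWeight p σ * x * d ^ 2 * h2
    rw [main]
    rcases lt_or_gt_of_ne hne with hl | hl
    · rw [if_neg hl.not_gt, if_pos hl]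
      have hy2 : 1 / 2 ≤ y := by rw [hy, (h _ _ hl).1]; exact (hq _).1
      have : (f σ - f σ') ^ 2 = d ^ 2 := by rw [hd]; ring
      rw [this, ← h1]
      nlinarith [mul_nonneg (mul_nonneg w2.le hd2) (sub_nonneg.2 hy2)]
    · rw [if_pos hl, if_neg hl.not_gt]
      have hx2 : 1 / 2 ≤ x := by rw [hx, (h _ _ hl).1]; exact (hq _).1
      nlinarith [mul_nonneg (mul_nonneg w1.le hd2) (sub_nonneg.2 hx2)]
  linarith

theorem sum_nnChain_mulVec {n : ℕ} (hn : 2 ≤ n) {q : Fin n → ℝ} {p : Fin n → Fin n → ℝ}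
    (h : HasWeapons q p) (f : Equiv.Perm (Fin n) → ℝ) :
    ∑ σ, permWeight p σ * (nnChain p).mulVec f σ = ∑ σ, permWeight p σ * f σ := by
  have hn0 : ((n - 1 : ℕ) : ℝ) ≠ 0 := Nat.cast_ne_zero.2 (by omega)
  simp_rw [nnChain_mulVec h, mul_left_comm (permWeight p _), ← Finset.mul_sum]
  simp_rw [Finset.mul_sum (Finset.univ : Finset (Fin (n - 1)))]
  rw [Finset.sum_comm]
  simp_rw [sum_edgeUpdate h]
  rw [Finset.sum_const, Finset.card_univ, Fintype.card_fin, nsmul_eq_mul, ← mul_assoc,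
    one_div_mul_cancel hn0, one_mul]

/-- The chain averages the `n - 1` edge updates, and the square is convex. Working with the second
moment directly avoids any discussion of negative eigenvalues. -/
theorem sqMoment_nnChain_le {n : ℕ} (hn : 2 ≤ n) {q : Fin n → ℝ} {p : Fin n → Fin n → ℝ}
    (h : HasWeapons q p) (hq : ∀ i, 1 / 2 ≤ q i ∧ q i < 1) (f : Equiv.Perm (Fin n) → ℝ) :
    sqMoment p ((nnChain p).mulVec f) ≤
      sqMoment p f - 1 / (2 * n) * totalEdgeForm p f := by
  have hq' : ∀ i, 0 < q i ∧ q i < 1 := fun i => ⟨by linarith [(hq i).1], (hq i).2⟩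
  set c : ℝ := ((n - 1 : ℕ) : ℝ) with hc
  have hc0 : 0 < c := Nat.cast_pos.2 (by omega)
  have hE : 0 ≤ totalEdgeForm p f := Finset.sum_nonneg fun e _ => edgeForm_nonneg h hq' e f
  have h1 : sqMoment p ((nnChain p).mulVec f) ≤
      1 / c * ∑ e, sqMoment p (edgeUpdate p e f) := by
    unfold sqMoment
    rw [Finset.sum_comm, Finset.mul_sum]
    refine Finset.sum_le_sum fun σ _ => ?_
    rw [nnChain_mulVec h, ← Finset.mul_sum, mul_left_comm]
    refine mul_le_mul_of_nonneg_left ?_ (permWeight_pos h hq' σ).le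
    have := sq_sum_le_card_mul_sum_sq (s := Finset.univ)
      (f := fun e => edgeUpdate p e f σ)
    rw [Finset.card_univ, Fintype.card_fin] at this
    rw [mul_pow]
    refine (mul_le_mul_of_nonneg_left this (sq_nonneg _)).trans (le_of_eq ?_)
    rw [← hc]
    field_simp
  have h2 : ∑ e, sqMoment p (edgeUpdate p e f) ≤
      c * sqMoment p f - 1 / 2 * totalEdgeForm p f := by
    refine (Finset.sum_le_sum fun e _ => sqMoment_edgeUpdate_le h hq e f).trans (le_of_eq ?_)
    rw [Finset.sum_sub_distrib, ← Finset.mul_sum]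
    simp [totalEdgeForm, hc]
  have h3 : (1 : ℝ) / (2 * n) ≤ 1 / (2 * c) := by
    refine one_div_le_one_div_of_le (by linarith) ?_
    have : c ≤ n := Nat.cast_le.2 (Nat.sub_le n 1)
    linarith
  have h4 := mul_le_mul_of_nonneg_left h2 (one_div_nonneg.2 hc0.le)
  have h5 := mul_le_mul_of_nonneg_right h3 hE
  have h6 : 1 / c * (c * sqMoment p f - 1 / 2 * totalEdgeForm p f) =
      sqMoment p f - 1 / (2 * c) * totalEdgeForm p f := by
    field_simp
  linarith

theorem sqMoment_le_of_sum_eq_zero {n : ℕ} {q : Fin n → ℝ} {p : Fin n → Fin n → ℝ} {T : ℝ}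
    (h : HasWeapons q p) (hq : ∀ i, 1 / 2 ≤ q i ∧ q i < 1)
    (hT : ∀ i, ∀ m ≤ n, ∑ j ∈ Finset.range m, ((1 - q i) / q i) ^ j ≤ T) (hT0 : 0 ≤ T)
    (f : Equiv.Perm (Fin n) → ℝ) (hf : ∑ σ, permWeight p σ * f σ = 0) :
    sqMoment p f ≤ 4 * (n : ℝ) ^ 4 * T * totalEdgeForm p f := by
  have hq' : ∀ i, 0 < q i ∧ q i < 1 := fun i => ⟨by linarith [(hq i).1], (hq i).2⟩
  have hZ : 0 < ∑ σ, permWeight p σ :=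
    Finset.sum_pos (fun σ _ => permWeight_pos h hq' σ) Finset.univ_nonempty
  have e : ∑ σ, ∑ ρ, permWeight p σ * permWeight p ρ * (f σ - f ρ) ^ 2 =
      2 * (∑ σ, permWeight p σ) * sqMoment p f := by
    have e1 : ∀ σ ρ, permWeight p σ * permWeight p ρ * (f σ - f ρ) ^ 2 =
        (permWeight p σ * f σ ^ 2) * permWeight p ρ +
        permWeight p σ * (permWeight p ρ * f ρ ^ 2) -
        2 * ((permWeight p σ * f σ) * (permWeight p ρ * f ρ)) := fun σ ρ => by ring
    simp_rw [e1, Finset.sum_sub_distrib, Finset.sum_add_distrib, ← Finset.mul_sum,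
      ← Finset.sum_mul, hf]
    unfold sqMoment
    ring
  have h1 := poincare_transForm n T n le_rfl q p h hq hT hT0 f
  rw [e] at h1
  have h2 := transForm_le h hq f
  have h3 : sqMoment p f ≤ n * T * transForm p f := by
    rw [mul_assoc (2 * _)] at h1
    exact le_of_mul_le_mul_left h1 (by linarith)
  refine h3.trans ((mul_le_mul_of_nonneg_left h2
    (mul_nonneg (Nat.cast_nonneg n) hT0)).trans (le_of_eq ?_))
  ring

theorem sqMoment_nnChain_contract {n : ℕ} (hn : 2 ≤ n) {q : Fin n → ℝ}
    {p : Fin n → Fin n → ℝ} {T : ℝ}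
    (h : HasWeapons q p) (hq : ∀ i, 1 / 2 ≤ q i ∧ q i < 1)
    (hT : ∀ i, ∀ m ≤ n, ∑ j ∈ Finset.range m, ((1 - q i) / q i) ^ j ≤ T) (hT0 : 0 < T)
    (f : Equiv.Perm (Fin n) → ℝ) (hf : ∑ σ, permWeight p σ * f σ = 0) :
    sqMoment p ((nnChain p).mulVec f) ≤ (1 - 1 / (8 * (n : ℝ) ^ 5 * T)) * sqMoment p f := by
  have h1 := sqMoment_nnChain_le hn h hq f
  have h2 := sqMoment_le_of_sum_eq_zero h hq hT hT0.le f hf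
  have hn0 : (0 : ℝ) < n := Nat.cast_pos.2 (by omega)
  have h3 := mul_le_mul_of_nonneg_left h2
    (one_div_nonneg.2 (by positivity : (0 : ℝ) ≤ 8 * (n : ℝ) ^ 5 * T))
  -- The rate comes from `8 * n ^ 5 * T = (2 * n) * (4 * n ^ 4 * T)`.
  have h4 : 1 / (8 * (n : ℝ) ^ 5 * T) * (4 * (n : ℝ) ^ 4 * T * totalEdgeForm p f) =
      1 / (2 * n) * totalEdgeForm p f := by
    field_simp
    ring
  linarith

theorem sqMoment_nnChain_pow_le {n : ℕ} (hn : 2 ≤ n) {q : Fin n → ℝ}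
    {p : Fin n → Fin n → ℝ} {T : ℝ}
    (h : HasWeapons q p) (hq : ∀ i, 1 / 2 ≤ q i ∧ q i < 1)
    (hT : ∀ i, ∀ m ≤ n, ∑ j ∈ Finset.range m, ((1 - q i) / q i) ^ j ≤ T) (hT1 : 1 ≤ T)
    (f : Equiv.Perm (Fin n) → ℝ) (hf : ∑ σ, permWeight p σ * f σ = 0) (t : ℕ) :
    sqMoment p ((nnChain p ^ t).mulVec f) ≤
      (1 - 1 / (8 * (n : ℝ) ^ 5 * T)) ^ t * sqMoment p f := by
  have hn1 : (1 : ℝ) ≤ n := Nat.one_le_cast.2 (by omega)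
  have hγ : 0 ≤ 1 - 1 / (8 * (n : ℝ) ^ 5 * T) := by
    rw [sub_nonneg, div_le_one (by positivity)]
    have : (1 : ℝ) ≤ (n : ℝ) ^ 5 := one_le_pow₀ hn1
    nlinarith
  have hmean : ∀ t, ∑ σ, permWeight p σ * (nnChain p ^ t).mulVec f σ = 0 := by
    intro t
    induction t with
    | zero => simpa using hf
    | succ t ih => rw [pow_succ', ← Matrix.mulVec_mulVec, sum_nnChain_mulVec hn h, ih]
  induction t with
  | zero => simp
  | succ t ih =>
    rw [pow_succ', ← Matrix.mulVec_mulVec, pow_succ', mul_assoc]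
    exact (sqMoment_nnChain_contract hn h hq hT (by linarith) _ (hmean t)).trans
      (mul_le_mul_of_nonneg_left ih hγ)

/-! ### From second moments to total variation -/

theorem nnChain_pow_mulVec_const {n : ℕ} (hn : 2 ≤ n) {q : Fin n → ℝ}
    {p : Fin n → Fin n → ℝ} (h : HasWeapons q p) (c : ℝ) (t : ℕ) :
    (nnChain p ^ t).mulVec (fun _ => c) = fun _ => c := by
  have hn0 : ((n - 1 : ℕ) : ℝ) ≠ 0 := Nat.cast_ne_zero.2 (by omega)
  induction t with
  | zero => simp
  | succ t ih =>
    rw [pow_succ', ← Matrix.mulVec_mulVec, ih]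
    ext σ
    rw [nnChain_mulVec h]
    simp only [edgeUpdate, sub_self, mul_zero, add_zero, Finset.sum_const, Finset.card_univ,
      Fintype.card_fin, nsmul_eq_mul]
    rw [← mul_assoc, one_div_mul_cancel hn0, one_mul]

/-- By duality the `ℓ¹` distance from row `x` is the value at `x` of `P ^ t` applied to a centred
sign function. That value is bounded through the single term of the second moment at `x`. -/
theorem tvDist_nnChain_le {n : ℕ} (hn : 2 ≤ n) {q : Fin n → ℝ}
    {p : Fin n → Fin n → ℝ} {T : ℝ}
    (h : HasWeapons q p) (hq : ∀ i, 1 / 2 ≤ q i ∧ q i < 1)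
    (hT : ∀ i, ∀ m ≤ n, ∑ j ∈ Finset.range m, ((1 - q i) / q i) ^ j ≤ T) (hT1 : 1 ≤ T)
    (t : ℕ) (ε : ℝ) (hε : 0 ≤ ε)
    (ht : ∀ σ, (1 - 1 / (8 * (n : ℝ) ^ 5 * T)) ^ t * ∑ ρ, permWeight p ρ ≤
      ε ^ 2 * permWeight p σ) :
    tvDist (nnChain p ^ t) (biasedPerm p) ≤ ε := by
  have hq' : ∀ i, 0 < q i ∧ q i < 1 := fun i => ⟨by linarith [(hq i).1], (hq i).2⟩
  have hn1 : (1 : ℝ) ≤ n := Nat.one_le_cast.2 (by omega)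
  have hγ : 0 ≤ 1 - 1 / (8 * (n : ℝ) ^ 5 * T) := by
    rw [sub_nonneg, div_le_one (by positivity)]
    have : (1 : ℝ) ≤ (n : ℝ) ^ 5 := one_le_pow₀ hn1
    nlinarith
  set Z := ∑ ρ, permWeight p ρ with hZ
  have hZ0 : 0 < Z :=
    Finset.sum_pos (fun σ _ => permWeight_pos h hq' σ) Finset.univ_nonempty
  refine ciSup_le fun x => ?_
  set D : Equiv.Perm (Fin n) → ℝ := fun y => (nnChain p ^ t) x y - biasedPerm p y with hD
  set g : Equiv.Perm (Fin n) → ℝ := fun y => if 0 ≤ D y then 1 else -1 with hg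
  have hg1 : ∀ y, |g y| ≤ 1 := fun y => by
    simp only [hg]
    split_ifs <;> simp
  set m : ℝ := ∑ y, biasedPerm p y * g y with hm
  have hπ0 : ∀ y, 0 ≤ biasedPerm p y := fun y => div_nonneg (permWeight_pos h hq' y).le hZ0.le
  have hπ1 : ∑ y, biasedPerm p y = 1 := by
    unfold biasedPerm
    rw [← Finset.sum_div]
    exact div_self hZ0.ne'
  have hm1 : |m| ≤ 1 := by
    rw [← hπ1]
    refine (Finset.abs_sum_le_sum_abs _ _).trans (Finset.sum_le_sum fun y _ => ?_)
    rw [abs_mul, abs_of_nonneg (hπ0 y)]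
    exact mul_le_of_le_one_right (hπ0 y) (hg1 y)
  set g₀ : Equiv.Perm (Fin n) → ℝ := fun y => g y - m with hg₀
  have hmean : ∑ y, permWeight p y * g₀ y = 0 := by
    have : ∑ y, permWeight p y * g y = Z * m := by
      rw [hm, Finset.mul_sum]
      refine Finset.sum_congr rfl fun y _ => ?_
      unfold biasedPerm
      rw [← hZ]
      field_simp
    simp only [hg₀, mul_sub, Finset.sum_sub_distrib, this, ← Finset.sum_mul]
    rw [← hZ, sub_self]
  have hval : ∑ y, |D y| = (nnChain p ^ t).mulVec g₀ x := by
    have e1 : g₀ = g - fun _ => m := rfl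
    rw [e1, Matrix.mulVec_sub, nnChain_pow_mulVec_const hn h, Pi.sub_apply, hm]
    simp only [Matrix.mulVec, dotProduct]
    rw [← Finset.sum_sub_distrib]
    refine Finset.sum_congr rfl fun y _ => ?_
    rw [← sub_mul]
    change |D y| = D y * g y
    simp only [hg]
    split_ifs with hy
    · rw [abs_of_nonneg hy, mul_one]
    · rw [abs_of_neg (not_le.1 hy), mul_neg_one]
  have hN : sqMoment p g₀ ≤ 4 * Z := by
    rw [hZ, Finset.mul_sum]
    refine Finset.sum_le_sum fun y _ => ?_
    -- Centring a sign function gives values of size at most `2`; the resulting `4` is cancelled by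
    -- the factor `1 / 2` in `tvDist`.
    have h2 : |g₀ y| ≤ 2 := (abs_sub _ _).trans (by linarith [hg1 y])
    have h3 : g₀ y ^ 2 ≤ 2 ^ 2 := sq_le_sq' (abs_le.1 h2).1 (abs_le.1 h2).2
    have := mul_le_mul_of_nonneg_left h3 (permWeight_pos h hq' y).le
    linarith
  have hpow := sqMoment_nnChain_pow_le hn h hq hT hT1 g₀ hmean t
  have hx : permWeight p x * (∑ y, |D y|) ^ 2 ≤
      sqMoment p ((nnChain p ^ t).mulVec g₀) := by
    rw [hval]
    exact Finset.single_le_sum (f := fun σ => permWeight p σ *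
      ((nnChain p ^ t).mulVec g₀ σ) ^ 2)
      (fun σ _ => mul_nonneg (permWeight_pos h hq' σ).le (sq_nonneg _)) (Finset.mem_univ x)
  have hw := permWeight_pos h hq' x
  have hfin : permWeight p x * (∑ y, |D y|) ^ 2 ≤ permWeight p x * (2 * ε) ^ 2 := by
    have := mul_le_mul_of_nonneg_left hN (pow_nonneg hγ t)
    linarith [ht x]
  have := abs_le_of_sq_le_sq (le_of_mul_le_mul_left hfin hw) (by linarith)
  linarith [le_abs_self (∑ y, |D y|)]

/-! ### Least probability and the mixing time -/

theorem HasWeapons.mem_Icc {n : ℕ} {q : Fin n → ℝ} {p : Fin n → Fin n → ℝ} {R : ℝ}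
    (h : HasWeapons q p) (hq : ∀ i, 1 / 2 ≤ q i ∧ q i ≤ R) (hR : R < 1) {i j : Fin n}
    (hij : i ≠ j) : 1 - R ≤ p i j ∧ p i j ≤ 1 := by
  rcases lt_or_gt_of_ne hij with hl | hl
  · rw [(h _ _ hl).1]
    constructor <;> linarith [(hq i).1, (hq i).2]
  · rw [(h _ _ hl).2]
    constructor <;> linarith [(hq j).1, (hq j).2]

theorem permWeight_le_one {n : ℕ} {q : Fin n → ℝ} {p : Fin n → Fin n → ℝ} {R : ℝ}
    (h : HasWeapons q p) (hq : ∀ i, 1 / 2 ≤ q i ∧ q i ≤ R) (hR : R < 1)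
    (σ : Equiv.Perm (Fin n)) : permWeight p σ ≤ 1 := by
  have hp : ∀ i, ∀ j ∈ Finset.Ioi i, 1 - R ≤ p (σ i) (σ j) ∧ p (σ i) (σ j) ≤ 1 :=
    fun i j hj => h.mem_Icc hq hR (σ.injective.ne (Finset.mem_Ioi.1 hj).ne)
  refine Finset.prod_le_one (fun i _ => Finset.prod_nonneg fun j hj => ?_)
    fun i _ => Finset.prod_le_one (fun j hj => ?_) fun j hj => (hp i j hj).2
  · linarith [(hp i j hj).1]
  · linarith [(hp i j hj).1]

theorem pow_le_permWeight {n : ℕ} {q : Fin n → ℝ} {p : Fin n → Fin n → ℝ} {R : ℝ}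
    (h : HasWeapons q p) (hq : ∀ i, 1 / 2 ≤ q i ∧ q i ≤ R) (hR : R < 1)
    (σ : Equiv.Perm (Fin n)) : (1 - R) ^ (n ^ 2) ≤ permWeight p σ := by
  have e : (1 - R) ^ (n ^ 2) = ∏ _i : Fin n, ∏ _j : Fin n, (1 - R) := by
    simp [← pow_mul, sq]
  rw [e, permWeight_eq_prod_ite]
  have h0 : 0 ≤ 1 - R := by linarith
  refine Finset.prod_le_prod (fun i _ => Finset.prod_nonneg fun j _ => h0) fun i _ =>
    Finset.prod_le_prod (fun j _ => h0) fun j _ => ?_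
  split_ifs with hij
  · exact (h.mem_Icc hq hR (σ.injective.ne hij.ne)).1
  · linarith [(hq i).1, (hq i).2]

theorem sum_permWeight_le {n : ℕ} {q : Fin n → ℝ} {p : Fin n → Fin n → ℝ} {R : ℝ}
    (h : HasWeapons q p) (hq : ∀ i, 1 / 2 ≤ q i ∧ q i ≤ R) (hR : R < 1) :
    ∑ σ, permWeight p σ ≤ Real.exp ((n : ℝ) ^ 2) := by
  calc ∑ σ, permWeight p σ ≤ ∑ _σ : Equiv.Perm (Fin n), (1 : ℝ) :=
        Finset.sum_le_sum fun σ _ => permWeight_le_one h hq hR σ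
    _ = (n.factorial : ℝ) := by simp [Fintype.card_perm]
    _ ≤ (n : ℝ) ^ n := by exact_mod_cast Nat.factorial_le_pow n
    _ ≤ Real.exp n ^ n :=
        pow_le_pow_left₀ (Nat.cast_nonneg n) (by linarith [Real.add_one_le_exp (n : ℝ)]) n
    _ = Real.exp ((n : ℝ) ^ 2) := by rw [← Real.exp_nat_mul, sq]

theorem exists_isMixingTime_le {Ω : Type*} [Fintype Ω] [DecidableEq Ω] {P : Matrix Ω Ω ℝ}
    {π : Ω → ℝ} {ε : ℝ} {t₀ : ℕ} (h : ∀ t, t₀ ≤ t → tvDist (P ^ t) π ≤ ε) :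
    ∃ τ, IsMixingTime P π ε τ ∧ τ ≤ t₀ :=
  ⟨sInf {t : ℕ | ∀ t' : ℕ, t ≤ t' → tvDist (P ^ t') π ≤ ε},
    ⟨Nat.sInf_mem ⟨t₀, h⟩, fun _ ht => Nat.sInf_le ht⟩, Nat.sInf_le h⟩

/-- Mixing time bound in terms of a bound `T` on the geometric sums with ratio
`(1 - q i) / q i`. -/
theorem exists_mixingTime_le {n : ℕ} (hn : 2 ≤ n) {q : Fin n → ℝ}
    {p : Fin n → Fin n → ℝ} {T R : ℝ} (hR : R < 1)
    (h : HasWeapons q p) (hq : ∀ i, 1 / 2 ≤ q i ∧ q i ≤ R)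
    (hT : ∀ i, ∀ m ≤ n, ∑ j ∈ Finset.range m, ((1 - q i) / q i) ^ j ≤ T)
    (ε : ℝ) (hε : 0 < ε) (hε1 : ε < 1) :
    ∃ τ : ℕ, IsMixingTime (nnChain p) (biasedPerm p) ε τ ∧
      (τ : ℝ) ≤ (8 * T * (4 + 2 * |Real.log (1 - R)|) + 2) *
        ((n : ℝ) ^ 7 * Real.log (n / ε)) := by
  have hq1 : ∀ i, 1 / 2 ≤ q i ∧ q i < 1 := fun i => ⟨(hq i).1, (hq i).2.trans_lt hR⟩
  have hn1 : (1 : ℝ) ≤ n := Nat.one_le_cast.2 (by omega)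
  have hT1 : 1 ≤ T := by simpa using hT ⟨0, by omega⟩ 1 (by omega)
  set L := |Real.log (1 - R)| with hL
  have hL0 : 0 ≤ L := abs_nonneg _
  set l := Real.log (n / ε) with hl
  have hlε : l = Real.log n - Real.log ε := Real.log_div (by linarith) hε.ne'
  have hlogε : Real.log ε < 0 := Real.log_neg hε hε1
  have hlogn : Real.log 2 ≤ Real.log n :=
    Real.log_le_log two_pos (by exact_mod_cast hn)
  have hlog2 := Real.log_two_gt_d9
  -- As `log 2 > 1 / 2`, multiples of `l` absorb additive constants, including the rounding up of
  -- `t₀`.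
  have hl1 : 1 ≤ 2 * l := by linarith
  set G : ℝ := 8 * (n : ℝ) ^ 5 * T with hG
  have hG0 : 0 < G := by positivity
  -- The exponent needed: `n ^ 2` for the normalizing sum, `L * n ^ 2` for the smallest weight, `-2
  -- * log ε` for `ε ^ 2`.
  set B : ℝ := (n : ℝ) ^ 2 * (1 + L) - 2 * Real.log ε with hB
  obtain ⟨τ, hτ, hle⟩ := exists_isMixingTime_le (P := nnChain p) (π := biasedPerm p) (ε := ε)
    (t₀ := ⌈G * B⌉₊) (fun t ht => by
      refine tvDist_nnChain_le hn h hq1 hT hT1 t ε hε.le fun σ => ?_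
      have htB : B ≤ 1 / G * t := by
        rw [one_div_mul_eq_div, le_div_iff₀ hG0, mul_comm]
        exact (Nat.le_ceil _).trans (Nat.cast_le.2 ht)
      have h1 : (1 - 1 / G) ^ t ≤ Real.exp (-B) := by
        have hg : 0 ≤ 1 - 1 / G := by
          rw [sub_nonneg, div_le_one hG0]
          have : (1 : ℝ) ≤ (n : ℝ) ^ 5 := one_le_pow₀ hn1
          nlinarith
        calc (1 - 1 / G) ^ t ≤ Real.exp (-(1 / G)) ^ t :=
              pow_le_pow_left₀ hg (Real.one_sub_le_exp_neg _) t
          _ = Real.exp (-(1 / G * t)) := by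
              rw [← Real.exp_nat_mul]
              congr 1
              ring
          _ ≤ _ := Real.exp_le_exp.2 (by linarith)
      have h2 := sum_permWeight_le h hq hR
      have h3 : Real.exp (-(L * (n : ℝ) ^ 2)) ≤ permWeight p σ := by
        refine le_trans ?_ (pow_le_permWeight h hq hR σ)
        have hR0 : 0 < 1 - R := by linarith
        rw [← Real.exp_log (pow_pos hR0 (n ^ 2)), Real.log_pow, Real.exp_le_exp]
        push_cast
        have := neg_abs_le (Real.log (1 - R))
        nlinarith [sq_nonneg (n : ℝ)]
      have h4 : ε ^ 2 = Real.exp (2 * Real.log ε) := by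
        rw [mul_comm, Real.exp_mul, Real.exp_log hε]
        norm_num
      have hZ0 : 0 ≤ ∑ ρ, permWeight p ρ := Finset.sum_nonneg fun ρ _ =>
        (permWeight_pos h (fun i => ⟨by linarith [(hq1 i).1], (hq1 i).2⟩) ρ).le
      calc (1 - 1 / G) ^ t * ∑ ρ, permWeight p ρ
          ≤ Real.exp (-B) * Real.exp ((n : ℝ) ^ 2) :=
            mul_le_mul h1 h2 hZ0 (Real.exp_pos _).le
        _ = ε ^ 2 * Real.exp (-(L * (n : ℝ) ^ 2)) := by
            rw [h4, ← Real.exp_add, ← Real.exp_add, hB]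
            congr 1
            ring
        _ ≤ _ := mul_le_mul_of_nonneg_left h3 (sq_nonneg ε))
  refine ⟨τ, hτ, ?_⟩
  have hn2 : (1 : ℝ) ≤ (n : ℝ) ^ 2 := one_le_pow₀ hn1
  have hn7 : (1 : ℝ) ≤ (n : ℝ) ^ 7 := one_le_pow₀ hn1
  have hB0 : 0 ≤ B := by
    have : 0 ≤ (n : ℝ) ^ 2 * (1 + L) := by positivity
    linarith
  have hBl : B ≤ (n : ℝ) ^ 2 * (4 + 2 * L) * l := by
    have a1 : (n : ℝ) ^ 2 * (1 + L) * 1 ≤ (n : ℝ) ^ 2 * (1 + L) * (2 * l) :=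
      mul_le_mul_of_nonneg_left hl1 (by positivity)
    have a2 : 1 * l ≤ (n : ℝ) ^ 2 * l := mul_le_mul_of_nonneg_right hn2 (by linarith)
    have a3 : -Real.log ε ≤ l := by linarith
    linarith
  have hceil : (⌈G * B⌉₊ : ℝ) ≤ G * B + 1 := (Nat.ceil_lt_add_one (by positivity)).le
  have hτ' : (τ : ℝ) ≤ ⌈G * B⌉₊ := Nat.cast_le.2 hle
  have b1 := mul_le_mul_of_nonneg_left hBl hG0.le
  have b2 : 1 * (2 * l) ≤ (n : ℝ) ^ 7 * (2 * l) :=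
    mul_le_mul_of_nonneg_right hn7 (by linarith)
  have b3 : G * ((n : ℝ) ^ 2 * (4 + 2 * L) * l) =
      8 * T * (4 + 2 * L) * ((n : ℝ) ^ 7 * l) := by
    rw [hG]
    ring
  linarith

/-! ### The two regimes -/

/-- The weapons of Choose Your Weapon parameters, the last element receiving that of its
predecessor. -/
theorem IsChooseYourWeapon.exists_hasWeapons {n : ℕ} (hn : 2 ≤ n) {r : Fin (n - 1) → ℝ}
    {p : Fin n → Fin n → ℝ} (h : IsChooseYourWeapon r p) {a b : ℝ}
    (hr : ∀ i, a ≤ r i ∧ r i ≤ b) :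
    ∃ q, HasWeapons q p ∧ ∀ i, a ≤ q i ∧ q i ≤ b := by
  refine ⟨fun i => r ⟨min i (n - 2), by omega⟩, fun i j hij => ?_, fun i => hr _⟩
  have e : (⟨min i (n - 2), by omega⟩ : Fin (n - 1)) = ⟨i, by omega⟩ := by
    ext
    simp only
    omega
  simp only [e]
  exact h i j hij

theorem sum_geom_le_card {q : ℝ} (hq : 1 / 2 ≤ q) (hq1 : q ≤ 1) {m n : ℕ} (hm : m ≤ n) :
    ∑ j ∈ Finset.range m, ((1 - q) / q) ^ j ≤ n := by
  have hx : (1 - q) / q ≤ 1 := (div_le_one (by linarith)).2 (by linarith)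
  have hx0 : 0 ≤ (1 - q) / q := div_nonneg (by linarith) (by linarith)
  refine (Finset.sum_le_sum fun j _ => pow_le_one₀ hx0 hx).trans ?_
  simpa using hm

theorem sum_geom_le_of_bias {q δ : ℝ} (hδ : 0 < δ) (hq : 1 / 2 + δ ≤ q) (hq1 : q ≤ 1)
    (m : ℕ) : ∑ j ∈ Finset.range m, ((1 - q) / q) ^ j ≤ 1 / (2 * δ) := by
  have hq0 : 0 < q := by linarith
  have hx0 : 0 ≤ (1 - q) / q := div_nonneg (by linarith) hq0.le
  -- The right side is `(2 * q - 1) / q`, with numerator at least `2 * δ` and `q ≤ 1`.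
  have hx : 2 * δ ≤ 1 - (1 - q) / q := by
    rw [le_sub_comm, div_le_iff₀ hq0]
    nlinarith
  have hg := mul_neg_geom_sum ((1 - q) / q) m
  have hs : 0 ≤ ∑ j ∈ Finset.range m, ((1 - q) / q) ^ j :=
    Finset.sum_nonneg fun j _ => pow_nonneg hx0 j
  rw [le_div_iff₀ (by linarith)]
  have h1 := mul_le_mul_of_nonneg_right hx hs
  linarith [pow_nonneg hx0 m]

theorem mainTheorem2 (R : ℝ) (hR : R < 1) :
    (∃ C : ℝ, 0 < C ∧
      ∀ (n : ℕ), 2 ≤ n → ∀ (r : Fin (n - 1) → ℝ) (p : Fin n → Fin n → ℝ),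
        (∀ i, 1 / 2 ≤ r i ∧ r i ≤ R) → IsChooseYourWeapon r p →
        ∀ ε : ℝ, 0 < ε → ε < 1 →
          ∃ τ : ℕ, IsMixingTime (nnChain p) (biasedPerm p) ε τ ∧
            (τ : ℝ) ≤ C * ((n : ℝ) ^ 8 * Real.log ((n : ℝ) / ε))) ∧
    (∀ δ : ℝ, 0 < δ → ∃ C : ℝ, 0 < C ∧
      ∀ (n : ℕ), 2 ≤ n → ∀ (r : Fin (n - 1) → ℝ) (p : Fin n → Fin n → ℝ),
        (∀ i, 1 / 2 + δ ≤ r i ∧ r i ≤ R) → IsChooseYourWeapon r p →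
        ∀ ε : ℝ, 0 < ε → ε < 1 →
          ∃ τ : ℕ, IsMixingTime (nnChain p) (biasedPerm p) ε τ ∧
            (τ : ℝ) ≤ C * ((n : ℝ) ^ 7 * Real.log ((n : ℝ) / ε))) := by
  refine ⟨⟨8 * (4 + 2 * |Real.log (1 - R)|) + 2, by positivity, ?_⟩, fun δ hδ =>
    ⟨8 * (1 / (2 * δ)) * (4 + 2 * |Real.log (1 - R)|) + 2, by positivity, ?_⟩⟩
  · intro n hn r p hr h ε hε hε1
    obtain ⟨q, hqp, hq⟩ := h.exists_hasWeapons hn hr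
    obtain ⟨τ, hτ, hle⟩ := exists_mixingTime_le hn hR hqp hq
      (fun i m hm => sum_geom_le_card (hq i).1 ((hq i).2.trans hR.le) hm) ε hε hε1
    refine ⟨τ, hτ, hle.trans ?_⟩
    have hn1 : (1 : ℝ) ≤ n := Nat.one_le_cast.2 (by omega)
    have hl : 0 ≤ Real.log (n / ε) :=
      Real.log_nonneg ((one_le_div hε).2 (by linarith))
    have hX : 0 ≤ (n : ℝ) ^ 7 * Real.log (n / ε) := by positivity
    have := mul_le_mul_of_nonneg_right hn1 (mul_nonneg zero_le_two hX)
    have e : (n : ℝ) ^ 8 = n * (n : ℝ) ^ 7 := by ring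
    rw [e]
    linarith
  · intro n hn r p hr h ε hε hε1
    obtain ⟨q, hqp, hq⟩ := h.exists_hasWeapons hn hr
    exact exists_mixingTime_le hn hR hqp (fun i => ⟨by linarith [(hq i).1], (hq i).2⟩)
      (fun i m _ => sum_geom_le_of_bias hδ (hq i).1 ((hq i).2.trans hR.le) m) ε hε hε1
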